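/- Let $\ell>0$ and let $\mathcal N$ be an inhomogeneous Poisson point process on $(0,\infty)$ with rate function $\mu$, i.e. with intensity measure $M(dt)=\mu(t)\,dt$, where $\mu(t)>0$ for Lebesgue-almost all $t>0$ and $\int_0^t\mu(s)\,ds<\infty$ for every $t>0$. Let $0<T_1<T_2<\cdots$ be the epochs of $\mathcal N$, with $T_0=0$ (and $T_{n+1}=\infty$ if there is no epoch after $T_n$), and let $$D=\min\{T_n:\ T_{n+1}-T_n\ge \ell\}$$ be the first epoch that is followed by a gap of size at least $\ell$, with $D=\infty$ if there is none. Write $f\approx_{\log}g$ if $\log f(t)/\log g(t)\to1$ as $t\to\infty$. Then the following hold. (i) If $\mu(t)=b\log t-\log a$ for all large $t$, with $a>0$ and $b\in(0,1/\ell)$, then $$\mathbb P(D>t)\approx_{\log}\exp\Bigl\{-\frac{b a^{\ell}}{1-b\ell}\,t^{1-b\ell}\log t\Bigr\}.$$ (ii) If $\ell=1$ and $\mu(t)=\log t-b\log\log t-\log a$ for all large $t$, with $a>0$ and $b>-2$, then $$\mathbb P(D>t)\approx_{\log}\exp\Bigl\{-\frac{a}{2+b}(\log t)^{2+b}\Bigr\}.$$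 (iii) If $\ell=1$ and $\mu(t)=\log t+2\log\log t-\log a$ for all large $t$, with $a>0$, then $$\mathbb P(D>t)\approx_{\log}(\log t)^{-a}.$$ -/

import Mathlib

open MeasureTheory ProbabilityTheory Filter Topology
open scoped ENNReal NNReal

noncomputable section

namespace PoissonGap

/-- The intensity measure `M(dt) = μ(t) dt` on `(0, ∞)` of the rate function `μ`. -/
def intensity (μ : ℝ → ℝ) : Measure ℝ :=
  (volume.restrict (Set.Ioi 0)).withDensity (fun t => ENNReal.ofReal (μ t))

/-- The number of points of the random set `N` in `A`. -/
def count {Ω : Type*} (N : Ω → Set ℝ) (A : Set ℝ) (ω : Ω) : ℕ∞ :=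
  (N ω ∩ A).encard

/-- The random subset `N` of `(0, ∞)` is a Poisson point process with rate function `μ`:
the number of points in a Borel set of finite intensity has the Poisson distribution with mean the
intensity, and the numbers of points in disjoint Borel sets are independent.
(In particular a set of finite intensity almost surely contains only finitely many points.) -/
structure IsPoissonProcess {Ω : Type*} [MeasurableSpace Ω] (P : Measure Ω)
    (μ : ℝ → ℝ) (N : Ω → Set ℝ) : Prop where
  subset_Ioi : ∀ ω, N ω ⊆ Set.Ioi 0
  measurable_count : ∀ A, MeasurableSet A → Measurable (count N A)
  hasLaw_count : ∀ A, MeasurableSet A → intensity μ A ≠ ⊤ →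
    HasLaw (count N A)
      ((poissonMeasure (intensity μ A).toNNReal).map (fun k : ℕ => (k : ℕ∞))) P
  indep_count : ∀ (n : ℕ) (A : Fin n → Set ℝ), (∀ i, MeasurableSet (A i)) →
    Pairwise (fun i j => Disjoint (A i) (A j)) → iIndepFun (fun i => count N (A i)) P

/-- The epochs `T₀ = 0 < T₁ < T₂ < ⋯` of a set `S` of points of `(0, ∞)`, in increasing order:
`Tₙ₊₁` is the first point of `S` after `Tₙ`, and it is `∞` if there is none. -/
def epoch (S : Set ℝ) : ℕ → ℝ≥0∞
  | 0 => 0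
  | n + 1 => sInf {x | epoch S n < x ∧ ∃ s ∈ S, x = ENNReal.ofReal s}

/-- `D = min {Tₙ : Tₙ₊₁ - Tₙ ≥ ℓ}`, the first epoch followed by a gap of size at least `ℓ`;
it is `∞` if there is no such epoch. (An index `n` with `Tₙ = ∞` contributes only `∞`, which does
not affect the infimum.) -/
def firstGap (ℓ : ℝ) (S : Set ℝ) : ℝ≥0∞ :=
  sInf {x | ∃ n, x = epoch S n ∧ epoch S n + ENNReal.ofReal ℓ ≤ epoch S (n + 1)}

/-- The tail probability `P(D > t)` (including the event `D = ∞`). -/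
def tail {Ω : Type*} [MeasurableSpace Ω] (P : Measure Ω) (N : Ω → Set ℝ) (ℓ t : ℝ) : ℝ :=
  P.real {ω | ENNReal.ofReal t < firstGap ℓ (N ω)}

/-- Logarithmic asymptotics: `log f(t) / log g(t) → 1` as `t → ∞`. -/
def LogAsymp (f g : ℝ → ℝ) : Prop :=
  Tendsto (fun t => Real.log (f t) / Real.log (g t)) atTop (𝓝 1)

end PoissonGap

end

/-! A point of the process near `s` appears at rate `μ s` and starts a gap of size `ℓ` with
probability about `exp (-(ℓ * μ s))`, so the first gap should have hazard rate `μ e^{-ℓμ}`. If `H' ~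
μ e^{-ℓμ}` and `H → ∞`, then `log P(D > t) ~ -H t` (`SlowRate.logAsymp_tail`). The three claims
follow by exhibiting `H`: a multiple of `t^(1-bℓ) log t`, of `(log t)^(2+b)`, and of `log log t`.

Both bounds use a grid of mesh `ℓ / m`.

Upper bound (`tail_le_exp`): let `E k` say that cell `k` is occupied and the next `m` cells are
empty. Each `E k` makes `D` occur almost surely. Nearby `E k` exclude each other and distant ones
are independent, so the probability that none occurs is at most `∏ (1 - P(E k))`.

Lower bound (`prod_noRun_le_tail`): a gap of size `ℓ` empties `m - 1` consecutive cells. Having no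
such run starting in a given block of length `ℓ` is increasing in the occupation of the cells, so by
Harris' inequality the probability for all blocks is at least the product. Within a block, one
decomposes according to the first run (`real_compl_noRun_le`).

As `m → ∞`, both estimates for block `i` are governed by `blockHazard μ ℓ i`, up to factors close to
`1` when `i` is large, because `μ → ∞` and `μ` is almost constant on windows of length `2ℓ`. Summing
over blocks gives increments of `H`. The finitely many early blocks cost only a constant, provided
that their lower bounds do not depend on `m` (`exists_le_real_noRun`). -/

noncomputable section

namespace PoissonGap

/-! ### Correlation inequalities: exclusion of nearby events, and Harris. -/

section General

variable {Ω : Type*} [MeasurableSpace Ω] {P : Measure Ω} [IsProbabilityMeasure P]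

/-- If events close to each other exclude each other and each is independent of the distant past,
then the probability that none of them happens is at most that for independent events. -/
lemma real_forall_notMem_le_exp {E : ℕ → Set Ω} (hE : ∀ k, MeasurableSet (E k)) (r : ℕ)
    (hdisj : ∀ j k, j < k → k ≤ j + r → Disjoint (E j) (E k))
    (hind : ∀ k, P.real ({ω | ∀ j < k - r, ω ∉ E j} ∩ E k)
      = P.real {ω | ∀ j < k - r, ω ∉ E j} * P.real (E k)) (n : ℕ) :
    P.real {ω | ∀ j < n, ω ∉ E j} ≤ Real.exp (-∑ k ∈ Finset.range n, P.real (E k)) := by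
  induction n with
  | zero => simp
  | succ n ih =>
    have h1 : {ω | ∀ j < n + 1, ω ∉ E j} = {ω | ∀ j < n, ω ∉ E j} \ E n := by
      ext ω
      simp only [Set.mem_ofPred_eq, Set.mem_sdiff, Nat.lt_succ_iff_lt_or_eq]
      exact ⟨fun h => ⟨fun j hj => h j (Or.inl hj), h n (Or.inr rfl)⟩,
        fun h j hj => hj.elim (h.1 j) (fun e => e ▸ h.2)⟩
    -- On `E n` the `r` preceding events fail automatically, so only the distant past, which is
    -- independent of `E n`, has to be imposed.
    have h2 : {ω | ∀ j < n, ω ∉ E j} ∩ E n = {ω | ∀ j < n - r, ω ∉ E j} ∩ E n := by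
      ext ω
      simp only [Set.mem_ofPred_eq, Set.mem_inter_iff]
      refine ⟨fun h => ⟨fun j hj => h.1 j (by omega), h.2⟩, fun h => ⟨fun j hj => ?_, h.2⟩⟩
      by_cases hjr : j < n - r
      · exact h.1 j hjr
      · exact fun hj' => (hdisj j n hj (by omega)).le_bot ⟨hj', h.2⟩
    have h3 : P.real {ω | ∀ j < n, ω ∉ E j} ≤ P.real {ω | ∀ j < n - r, ω ∉ E j} :=
      measureReal_mono (fun ω h j hj => h j (by omega))
    have h4 := measureReal_inter_add_sdiff (μ := P) (s := {ω | ∀ j < n, ω ∉ E j}) (hE n)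
    rw [h2, hind, ← h1] at h4
    have h5 : P.real {ω | ∀ j < n + 1, ω ∉ E j}
        ≤ P.real {ω | ∀ j < n, ω ∉ E j} * (1 - P.real (E n)) := by
      have := mul_le_mul_of_nonneg_right h3 (measureReal_nonneg (μ := P) (s := E n))
      linarith
    rw [Finset.sum_range_succ, neg_add, Real.exp_add]
    refine h5.trans (mul_le_mul ih ?_ ?_ (Real.exp_pos _).le)
    · have := Real.add_one_le_exp (-P.real (E n)); linarith
    · linarith [measureReal_le_one (μ := P) (s := E n)]

/-- Probabilities of events depending on finitely many independent Boolean variables, as sums. -/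
lemma real_preimage_eq_sum {K : ℕ} {X : Fin K → Ω → Bool} (hX : ∀ i, Measurable (X i))
    (hind : iIndepFun X P) (A : Set (Fin K → Bool)) :
    P.real {ω | (fun i => X i ω) ∈ A}
      = ∑ x : Fin K → Bool, (∏ i, P.real (X i ⁻¹' {x i})) * A.indicator 1 x := by
  classical
  have hXm : Measurable (fun ω i => X i ω) := measurable_pi_iff.mpr hX
  have hsing : ∀ x : Fin K → Bool,
      P.real ((fun ω i => X i ω) ⁻¹' {x}) = ∏ i, P.real (X i ⁻¹' {x i}) := by
    intro x
    have h1 : ((fun ω i => X i ω) ⁻¹' {x}) = ⋂ i ∈ Finset.univ, X i ⁻¹' {x i} := by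
      ext ω; simp [funext_iff]
    rw [h1, measureReal_def, hind.measure_inter_preimage_eq_mul Finset.univ
      (sets := fun i => {x i}) (fun _ _ => measurableSet_singleton _), ENNReal.toReal_prod]
    rfl
  have h2 : {ω | (fun i => X i ω) ∈ A}
      = ⋃ x ∈ (Finset.univ.filter (· ∈ A)), ((fun ω i => X i ω) ⁻¹' {x}) := by
    ext ω; simp
  rw [h2, measureReal_biUnion_finset]
  · rw [Finset.sum_filter]
    refine Finset.sum_congr rfl fun x _ => ?_
    by_cases hx : x ∈ A <;> simp [hx, hsing]
  · intro x _ y _ hxy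
    exact Disjoint.preimage _ (by simpa using hxy)
  · exact fun x _ => hXm (measurableSet_singleton x)

/-- Harris' inequality for two increasing events. -/
lemma harris_two {K : ℕ} {X : Fin K → Ω → Bool} (hX : ∀ i, Measurable (X i))
    (hind : iIndepFun X P) {A B : Set (Fin K → Bool)} (hA : IsUpperSet A) (hB : IsUpperSet B) :
    P.real {ω | (fun i => X i ω) ∈ A} * P.real {ω | (fun i => X i ω) ∈ B}
      ≤ P.real {ω | (fun i => X i ω) ∈ A ∩ B} := by
  have hmono : ∀ {C : Set (Fin K → Bool)}, IsUpperSet C →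
      Monotone (C.indicator (1 : (Fin K → Bool) → ℝ)) := by
    intro C hC x y hxy
    by_cases hx : x ∈ C
    · simp [hx, hC hxy hx]
    · by_cases hy : y ∈ C <;> simp [hx, hy]
  have hnn : ∀ C : Set (Fin K → Bool), 0 ≤ C.indicator (1 : (Fin K → Bool) → ℝ) :=
    fun C x => Set.indicator_nonneg (fun _ _ => zero_le_one) x
  -- Product weights satisfy the lattice condition of FKG with equality: in each coordinate, `a ⊓ b`
  -- and `a ⊔ b` are `a` and `b` in some order.
  have key := fkg (α := Fin K → Bool) (β := ℝ)
    (μ := fun x => ∏ i, P.real (X i ⁻¹' {x i})) (f := A.indicator 1) (g := B.indicator 1)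
    (fun x => Finset.prod_nonneg fun _ _ => measureReal_nonneg) (hnn A) (hnn B) (hmono hA)
    (hmono hB) (by
      intro a b
      rw [← Finset.prod_mul_distrib, ← Finset.prod_mul_distrib]
      refine le_of_eq (Finset.prod_congr rfl fun i _ => ?_)
      rcases le_total (a i) (b i) with h | h
      · simp [h]
      · simp [h, mul_comm])
  have huniv := real_preimage_eq_sum hX hind Set.univ
  simp only [Set.mem_univ, Set.ofPred_true, probReal_univ, Set.indicator_univ, Pi.one_apply,
    mul_one] at huniv
  rw [← huniv, one_mul] at key
  rw [real_preimage_eq_sum hX hind, real_preimage_eq_sum hX hind, real_preimage_eq_sum hX hind]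
  refine key.trans (le_of_eq (Finset.sum_congr rfl fun x _ => ?_))
  rw [Set.inter_indicator_one]; rfl

/-- Harris' inequality: increasing events are positively correlated. -/
lemma harris {K : ℕ} {X : Fin K → Ω → Bool} (hX : ∀ i, Measurable (X i))
    (hind : iIndepFun X P) {A : ℕ → Set (Fin K → Bool)} (hA : ∀ i, IsUpperSet (A i)) (n : ℕ) :
    ∏ i ∈ Finset.range n, P.real {ω | (fun j => X j ω) ∈ A i}
      ≤ P.real {ω | ∀ i < n, (fun j => X j ω) ∈ A i} := by
  induction n with
  | zero => simp
  | succ n ih =>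
    have hB : IsUpperSet {x | ∀ i < n, x ∈ A i} := fun x y hxy hx i hi => hA i hxy (hx i hi)
    rw [Finset.prod_range_succ]
    refine (mul_le_mul_of_nonneg_right ih measureReal_nonneg).trans
      ((harris_two hX hind hB (hA n)).trans (measureReal_mono ?_))
    rintro ω ⟨h1, h2⟩ i hi
    rcases Nat.lt_succ_iff_lt_or_eq.mp hi with h | rfl
    · exact h1 i h
    · exact h2

end General

lemma count_eq_zero_iff {Ω : Type*} {N : Ω → Set ℝ} {A : Set ℝ} {ω : Ω} : count N A ω = 0 ↔ ∀ x ∈ N ω, x ∉ A := by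
  rw [count, Set.encard_eq_zero, Set.eq_empty_iff_forall_notMem]
  exact ⟨fun h x hx hA => h x ⟨hx, hA⟩, fun h x hx => h x hx.1 hx.2⟩

/-! ### Intensities of intervals and void probabilities. -/

section Intensity

variable {Ω : Type*} [MeasurableSpace Ω] {P : Measure Ω} {μ : ℝ → ℝ} {N : Ω → Set ℝ}

lemma intensity_apply (μ : ℝ → ℝ) {A : Set ℝ} (hA : MeasurableSet A) :
    intensity μ A = ∫⁻ t in A ∩ Set.Ioi 0, ENNReal.ofReal (μ t) := by
  rw [intensity, withDensity_apply _ hA, Measure.restrict_restrict hA]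

lemma intensity_ne_top (hμint : ∀ t : ℝ, 0 < t → IntegrableOn μ (Set.Ioc 0 t)) {A : Set ℝ}
    (hA : MeasurableSet A) {v : ℝ} (hAv : A ⊆ Set.Iio v) : intensity μ A ≠ ⊤ := by
  rw [intensity_apply μ hA]
  have hv : (0 : ℝ) < max v 1 := lt_of_lt_of_le one_pos (le_max_right _ _)
  have h1 : IntegrableOn μ (A ∩ Set.Ioi 0) :=
    (hμint _ hv).mono_set fun x hx => ⟨hx.2, (hAv hx.1).le.trans (le_max_left _ _)⟩
  refine ne_top_of_le_ne_top h1.2.ne (lintegral_mono fun x => ?_)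
  exact Real.ofReal_le_enorm (μ x)

lemma intensity_Ico_pos (hμpos : ∀ᵐ t ∂(volume.restrict (Set.Ioi (0 : ℝ))), 0 < μ t)
    (hμint : ∀ t : ℝ, 0 < t → IntegrableOn μ (Set.Ioc 0 t)) {u v : ℝ} (hu : 0 ≤ u) (huv : u < v) :
    0 < (intensity μ (Set.Ico u v)).toReal := by
  refine ENNReal.toReal_pos (fun h => ?_)
    (intensity_ne_top hμint measurableSet_Ico Set.Ico_subset_Iio_self)
  rw [intensity_apply μ measurableSet_Ico] at h
  have hm : IntegrableOn μ (Set.Ico u v ∩ Set.Ioi 0) :=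
    (hμint v (hu.trans_lt huv)).mono_set fun x hx => ⟨hx.2, hx.1.2.le⟩
  rw [lintegral_eq_zero_iff' hm.1.aemeasurable.ennreal_ofReal] at h
  have h2 : ∀ᵐ t ∂(volume.restrict (Set.Ico u v ∩ Set.Ioi 0)), 0 < μ t :=
    ae_mono (Measure.restrict_mono Set.inter_subset_right le_rfl) hμpos
  have h3 : ∀ᵐ t ∂(volume.restrict (Set.Ico u v ∩ Set.Ioi (0 : ℝ))), False := by
    filter_upwards [h, h2] with t ht1 ht2
    exact (ENNReal.ofReal_pos.mpr ht2).ne' ht1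
  rw [ae_iff] at h3
  simp only [not_false_eq_true, Set.ofPred_true, Measure.restrict_apply_univ] at h3
  have h4 : volume (Set.Ioo u v) ≤ volume (Set.Ico u v ∩ Set.Ioi (0 : ℝ)) :=
    measure_mono fun x hx => ⟨⟨hx.1.le, hx.2⟩, hu.trans_lt hx.1⟩
  rw [h3, Real.volume_Ioo] at h4
  simp at h4
  linarith

lemma le_intensity_Ico (hμint : ∀ t : ℝ, 0 < t → IntegrableOn μ (Set.Ioc 0 t)) {u v c : ℝ}
    (hu : 0 < u) (huv : u ≤ v) (hc : ∀ x ∈ Set.Ico u v, c ≤ μ x) :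
    c * (v - u) ≤ (intensity μ (Set.Ico u v)).toReal := by
  rw [← ENNReal.ofReal_le_iff_le_toReal
    (intensity_ne_top hμint measurableSet_Ico Set.Ico_subset_Iio_self),
    intensity_apply μ measurableSet_Ico,
    Set.inter_eq_left.mpr (fun x hx => Set.mem_Ioi.mpr (hu.trans_le hx.1)),
    ENNReal.ofReal_mul' (by linarith), ← Real.volume_Ico, ← setLIntegral_const]
  exact setLIntegral_mono' measurableSet_Ico fun x hx => ENNReal.ofReal_le_ofReal (hc x hx)

lemma intensity_Ico_le {u v c : ℝ}
    (hu : 0 < u) (huv : u ≤ v) (hc0 : 0 ≤ c) (hc : ∀ x ∈ Set.Ico u v, μ x ≤ c) :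
    (intensity μ (Set.Ico u v)).toReal ≤ c * (v - u) := by
  refine ENNReal.toReal_le_of_le_ofReal (mul_nonneg hc0 (by linarith)) ?_
  rw [intensity_apply μ measurableSet_Ico,
    Set.inter_eq_left.mpr (fun x hx => Set.mem_Ioi.mpr (hu.trans_le hx.1)),
    ENNReal.ofReal_mul' (by linarith), ← Real.volume_Ico, ← setLIntegral_const]
  exact setLIntegral_mono' measurableSet_Ico fun x hx => ENNReal.ofReal_le_ofReal (hc x hx)

lemma measurableSet_count_eq_zero (hN : IsPoissonProcess P μ N) {A : Set ℝ}
    (hA : MeasurableSet A) : MeasurableSet {ω | count N A ω = 0} :=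
  hN.measurable_count A hA (measurableSet_singleton 0)

/-- The void probabilities of a Poisson process. -/
lemma real_count_eq_zero (hN : IsPoissonProcess P μ N) {A : Set ℝ}
    (hA : MeasurableSet A) (hfin : intensity μ A ≠ ⊤) :
    P.real {ω | count N A ω = 0} = Real.exp (-(intensity μ A).toReal) := by
  have hs : MeasurableSet {k : ℕ∞ | k = 0} := measurableSet_singleton 0
  have h := (hN.hasLaw_count A hA hfin).measure_eq hs
  rw [measureReal_def, h, Measure.map_apply (measurable_of_countable _) hs]
  have : (fun k : ℕ => (k : ℕ∞)) ⁻¹' {x | x = 0} = {0} := by ext; simp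
  rw [this, poissonMeasure_singleton]
  simp [ENNReal.toReal_ofReal (Real.exp_pos _).le]
  rfl

lemma real_count_ne_zero [IsProbabilityMeasure P] (hN : IsPoissonProcess P μ N) {A : Set ℝ}
    (hA : MeasurableSet A) (hfin : intensity μ A ≠ ⊤) :
    P.real {ω | count N A ω ≠ 0} = 1 - Real.exp (-(intensity μ A).toReal) := by
  rw [← real_count_eq_zero hN hA hfin, ← probReal_compl_eq_one_sub (measurableSet_count_eq_zero hN hA)]
  rfl

lemma ae_count_ne_top (hN : IsPoissonProcess P μ N) {A : Set ℝ}
    (hA : MeasurableSet A) (hfin : intensity μ A ≠ ⊤) : ∀ᵐ ω ∂P, count N A ω ≠ ⊤ := by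
  have hs : MeasurableSet {k : ℕ∞ | k = ⊤} := measurableSet_singleton ⊤
  have h := (hN.hasLaw_count A hA hfin).measure_eq hs
  rw [Measure.map_apply (measurable_of_countable _) hs] at h
  have h0 : (fun k : ℕ => (k : ℕ∞)) ⁻¹' {x | x = ⊤} = ∅ := by ext; simp
  rw [h0, measure_empty] at h
  rw [ae_iff]
  simpa using h

lemma ae_finite_inter_Iio (hμint : ∀ t : ℝ, 0 < t → IntegrableOn μ (Set.Ioc 0 t))
    (hN : IsPoissonProcess P μ N) : ∀ᵐ ω ∂P, ∀ v : ℝ, (N ω ∩ Set.Iio v).Finite := by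
  have h : ∀ᵐ ω ∂P, ∀ n : ℕ, count N (Set.Iio (n : ℝ)) ω ≠ ⊤ := ae_all_iff.mpr fun n =>
    ae_count_ne_top hN measurableSet_Iio (intensity_ne_top hμint measurableSet_Iio le_rfl)
  filter_upwards [h] with ω hω v
  obtain ⟨n, hn⟩ := exists_nat_ge v
  have := Set.encard_ne_top_iff.mp (hω n)
  exact this.subset fun x hx => ⟨hx.1, lt_of_lt_of_le hx.2 hn⟩

/-- The numbers of points in the members of a sequence of disjoint sets are independent. -/
lemma iIndepFun_count (hN : IsPoissonProcess P μ N) {A : ℕ → Set ℝ}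
    (hA : ∀ i, MeasurableSet (A i)) (hd : Pairwise fun i j => Disjoint (A i) (A j)) :
    iIndepFun (fun i => count N (A i)) P := by
  rw [iIndepFun_iff_finset]
  intro s
  have h := hN.indep_count s.card (fun i => A (s.equivFin.symm i)) (fun i => hA _)
    (fun i j hij => hd fun h => hij (s.equivFin.symm.injective (Subtype.ext h)))
  have h2 := h.precomp (g := s.equivFin) s.equivFin.injective
  simpa [Finset.restrict_def] using h2

/-- The events that `A` is occupied and that `B` is empty are independent for disjoint `A`, `B`. -/
lemma real_count_ne_zero_inter_eq_zero [IsProbabilityMeasure P] (hN : IsPoissonProcess P μ N)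
    {A B : Set ℝ} (hA : MeasurableSet A) (hB : MeasurableSet B) (hd : Disjoint A B)
    (hAf : intensity μ A ≠ ⊤) (hBf : intensity μ B ≠ ⊤) :
    P.real ({ω | count N A ω ≠ 0} ∩ {ω | count N B ω = 0})
      = (1 - Real.exp (-(intensity μ A).toReal)) * Real.exp (-(intensity μ B).toReal) := by
  have h := hN.indep_count 2 ![A, B] (by intro i; fin_cases i <;> simpa)
    (by intro i j hij; fin_cases i <;> fin_cases j <;> simp_all [disjoint_comm])
  have h2 := (h.indepFun (i := 0) (j := 1) (by simp)).measure_inter_preimage_eq_mul {0}ᶜ {0}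
    (measurableSet_singleton 0).compl (measurableSet_singleton 0)
  rw [← real_count_ne_zero hN hA hAf, ← real_count_eq_zero hN hB hBf, measureReal_def,
    measureReal_def, measureReal_def, ← ENNReal.toReal_mul]
  congr 1

end Intensity

/-! ### Deterministic relation between empty intervals and the first gap. -/

section Epochs

variable {S : Set ℝ} {ℓ : ℝ}

lemma epoch_succ_eq {k : ℕ} {a s : ℝ} (ha : 0 ≤ a) (hk : epoch S k = ENNReal.ofReal a)
    (hs : s ∈ S) (has : a < s) (hmin : ∀ x ∈ S, a < x → s ≤ x) :
    epoch S (k + 1) = ENNReal.ofReal s := by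
  rw [epoch, hk]
  refine le_antisymm (sInf_le ⟨?_, s, hs, rfl⟩) (le_sInf ?_)
  · exact (ENNReal.ofReal_lt_ofReal_iff (ha.trans_lt has)).mpr has
  · rintro _ ⟨hx, x, hxS, rfl⟩
    exact ENNReal.ofReal_le_ofReal (hmin x hxS (lt_of_not_ge fun h =>
      absurd hx (not_lt.mpr (ENNReal.ofReal_le_ofReal h))))

/-- Every point of a locally finite subset of `(0, ∞)` is an epoch. -/
lemma exists_epoch_eq (hS : S ⊆ Set.Ioi 0) (hfin : ∀ v, (S ∩ Set.Iio v).Finite) {s : ℝ}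
    (hs : s ∈ S) : ∃ n, epoch S n = ENNReal.ofReal s := by
  induction h : (S ∩ Set.Iio s).ncard using Nat.strong_induction_on generalizing s with
  | _ n ih =>
    rcases (S ∩ Set.Iio s).eq_empty_or_nonempty with h0 | h0
    · refine ⟨1, epoch_succ_eq le_rfl (by simp [epoch]) hs (hS hs) fun x hx _ => ?_⟩
      by_contra! hlt
      exact (Set.eq_empty_iff_forall_notMem.mp h0) x ⟨hx, hlt⟩
    -- The predecessor `a` of `s` has fewer points before it, so it is an epoch by induction, and
    -- `s` is the next one.
    · obtain ⟨a, ⟨haS, has⟩, hmax⟩ := (hfin s).exists_maximal h0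
      have hlt : (S ∩ Set.Iio a).ncard < n := by
        rw [← h]
        refine Set.ncard_lt_ncard ⟨fun x hx => ⟨hx.1, (Set.mem_Iio.mp hx.2).trans has⟩, fun hsub => ?_⟩ (hfin s)
        exact lt_irrefl a (hsub ⟨haS, has⟩).2
      obtain ⟨k, hk⟩ := ih _ hlt haS rfl
      refine ⟨k + 1, epoch_succ_eq (hS haS).le hk hs has fun x hx hax => ?_⟩
      by_contra! hlt
      exact absurd (hmax ⟨hx, hlt⟩ hax.le) (not_le.mpr hax)

/-- An occupied interval followed by an empty one of length `ℓ` makes the first gap occur. -/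
lemma firstGap_lt (hℓ : 0 < ℓ) (hS : S ⊆ Set.Ioi 0) (hfin : ∀ v, (S ∩ Set.Iio v).Finite)
    {u v : ℝ} (hocc : ∃ x ∈ S, x ∈ Set.Ico u v) (hemp : ∀ x ∈ S, x ∉ Set.Ico v (v + ℓ)) :
    firstGap ℓ S < ENNReal.ofReal v := by
  obtain ⟨x, hx, hxu, hxv⟩ := hocc
  -- The last point before `v` is an epoch whose successor is at least `v + ℓ`.
  obtain ⟨a, ⟨haS, hav⟩, hmax⟩ := (hfin v).exists_maximal ⟨x, hx, hxv⟩
  obtain ⟨n, hn⟩ := exists_epoch_eq hS hfin haS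
  have ha : 0 < a := hS haS
  have hav : a < v := hav
  refine lt_of_le_of_lt (b := ENNReal.ofReal a) (sInf_le ⟨n, hn.symm, ?_⟩)
    ((ENNReal.ofReal_lt_ofReal_iff (ha.trans hav)).mpr hav)
  rw [epoch, hn, ← ENNReal.ofReal_add ha.le hℓ.le]
  refine le_sInf ?_
  rintro _ ⟨hy, y, hyS, rfl⟩
  refine ENNReal.ofReal_le_ofReal ?_
  have hay : a < y := lt_of_not_ge fun h =>
    absurd hy (not_lt.mpr (ENNReal.ofReal_le_ofReal h))
  by_contra! hlt
  refine hemp y hyS ⟨?_, by linarith⟩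
  by_contra! hyv
  exact absurd (hmax ⟨hyS, hyv⟩ hay.le) (not_le.mpr hay)

/-- If the first gap occurs before `v`, some point of `[0, v)` is followed by a gap. -/
lemma exists_gap_of_firstGap_lt (hℓ : 0 < ℓ) {v : ℝ} (h : firstGap ℓ S < ENNReal.ofReal v) :
    ∃ T, 0 ≤ T ∧ T < v ∧ ∀ x ∈ S, T < x → T + ℓ ≤ x := by
  obtain ⟨_, ⟨n, rfl, hn⟩, hlt⟩ := sInf_lt_iff.mp h
  have htop : epoch S n ≠ ⊤ := hlt.ne_top
  have hT : ENNReal.ofReal (epoch S n).toReal = epoch S n := ENNReal.ofReal_toReal htop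
  refine ⟨(epoch S n).toReal, ENNReal.toReal_nonneg, ?_, fun x hx hTx => ?_⟩
  · exact (ENNReal.lt_ofReal_iff_toReal_lt htop).mp hlt
  · have h1 : epoch S (n + 1) ≤ ENNReal.ofReal x := by
      rw [epoch]
      refine sInf_le ⟨?_, x, hx, rfl⟩
      exact (ENNReal.lt_ofReal_iff_toReal_lt htop).mpr hTx
    have h2 := hn.trans h1
    rw [← hT, ← ENNReal.ofReal_add ENNReal.toReal_nonneg hℓ.le] at h2
    exact (ENNReal.ofReal_le_ofReal_iff (ENNReal.toReal_nonneg.trans hTx.le)).mp h2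

end Epochs

/-! ### Grids of mesh `ℓ / m`. -/

section Grid

/-- The points of the grid of mesh `ℓ / m`. -/
def grid (ℓ : ℝ) (m j : ℕ) : ℝ := ℓ * j / m

/-- The cells of the grid of mesh `ℓ / m`. -/
def cell (ℓ : ℝ) (m j : ℕ) : Set ℝ := Set.Ico (grid ℓ m j) (grid ℓ m (j + 1))

variable {ℓ : ℝ} {m : ℕ}

lemma grid_strictMono (hℓ : 0 < ℓ) (hm : 0 < m) : StrictMono (grid ℓ m) := by
  intro i j hij
  have : (i : ℝ) < j := by exact_mod_cast hij
  have hm' : (0 : ℝ) < m := by exact_mod_cast hm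
  unfold grid
  gcongr

lemma grid_nonneg (hℓ : 0 < ℓ) (j : ℕ) : 0 ≤ grid ℓ m j := by unfold grid; positivity

lemma grid_mul (hm : 0 < m) (i : ℕ) : grid ℓ m (i * m) = ℓ * i := by
  have hm' : (m : ℝ) ≠ 0 := by exact_mod_cast hm.ne'
  unfold grid; push_cast; field_simp

lemma grid_add_self (hm : 0 < m) (j : ℕ) : grid ℓ m (j + m) = grid ℓ m j + ℓ := by
  have hm' : (m : ℝ) ≠ 0 := by exact_mod_cast hm.ne'
  unfold grid; push_cast; field_simp

lemma grid_succ (j : ℕ) : grid ℓ m (j + 1) = grid ℓ m j + ℓ / m := by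
  unfold grid; push_cast; ring

lemma exists_mem_cell (hℓ : 0 < ℓ) (hm : 0 < m) {x : ℝ} (hx : 0 ≤ x) : ∃ j, x ∈ cell ℓ m j := by
  have hm' : (0 : ℝ) < m := by exact_mod_cast hm
  refine ⟨⌊x * m / ℓ⌋₊, ?_, ?_⟩
  · have := Nat.floor_le (show 0 ≤ x * m / ℓ by positivity)
    rw [le_div_iff₀ hℓ] at this
    rw [grid, div_le_iff₀ hm']; linarith
  · have := Nat.lt_floor_add_one (x * m / ℓ)
    rw [div_lt_iff₀ hℓ] at this
    rw [grid, lt_div_iff₀ hm']; push_cast; linarith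

lemma exists_mem_cell_of_mem_Ico (hℓ : 0 < ℓ) (hm : 0 < m) {a b : ℕ} {x : ℝ}
    (hx : x ∈ Set.Ico (grid ℓ m a) (grid ℓ m b)) : ∃ j, a ≤ j ∧ j < b ∧ x ∈ cell ℓ m j := by
  obtain ⟨j, hj⟩ := exists_mem_cell hℓ hm ((grid_nonneg hℓ a).trans hx.1)
  have h1 := (grid_strictMono hℓ hm).lt_iff_lt.mp (hx.1.trans_lt hj.2)
  have h2 := (grid_strictMono hℓ hm).lt_iff_lt.mp (hj.1.trans_lt hx.2)
  exact ⟨j, by omega, h2, hj⟩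

lemma cell_subset_Ico (hℓ : 0 < ℓ) (hm : 0 < m) {a b j : ℕ} (ha : a ≤ j) (hb : j < b) :
    cell ℓ m j ⊆ Set.Ico (grid ℓ m a) (grid ℓ m b) :=
  Set.Ico_subset_Ico ((grid_strictMono hℓ hm).monotone ha)
    ((grid_strictMono hℓ hm).monotone hb)

lemma measurableSet_cell (j : ℕ) : MeasurableSet (cell ℓ m j) := measurableSet_Ico

lemma pairwise_disjoint_cell (hℓ : 0 < ℓ) (hm : 0 < m) :
    Pairwise fun i j => Disjoint (cell ℓ m i) (cell ℓ m j) := by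
  intro i j hij
  wlog h : i < j generalizing i j
  · exact (this hij.symm (by omega)).symm
  refine Set.disjoint_left.mpr fun x hx hy => ?_
  exact absurd (hx.2.trans_le ((grid_strictMono hℓ hm).monotone h)) (not_lt.mpr hy.1)

lemma count_Ico_grid_eq_zero_iff {Ω : Type*} {N : Ω → Set ℝ} (hℓ : 0 < ℓ) (hm : 0 < m)
    {a b : ℕ} {ω : Ω} : count N (Set.Ico (grid ℓ m a) (grid ℓ m b)) ω = 0
      ↔ ∀ j, a ≤ j → j < b → count N (cell ℓ m j) ω = 0 := by
  simp only [count_eq_zero_iff]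
  refine ⟨fun h j ha hb x hx hxc => h x hx (cell_subset_Ico hℓ hm ha hb hxc),
    fun h x hx hxc => ?_⟩
  obtain ⟨j, ha, hb, hj⟩ := exists_mem_cell_of_mem_Ico hℓ hm hxc
  exact h j ha hb x hx hj

end Grid

/-! ### Independent occupation variables of the cells. -/

section Occupation

open Classical in
/-- Whether a cell of the grid contains a point. -/
def occ {Ω : Type*} (N : Ω → Set ℝ) (ℓ : ℝ) (m j : ℕ) (ω : Ω) : Bool :=
  decide (count N (cell ℓ m j) ω ≠ 0)

variable {Ω : Type*} [MeasurableSpace Ω] {P : Measure Ω} {μ : ℝ → ℝ} {N : Ω → Set ℝ}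
  {ℓ : ℝ} {m : ℕ}

lemma measurable_occ (hN : IsPoissonProcess P μ N) (j : ℕ) : Measurable (occ N ℓ m j) := by
  classical
  exact (measurable_of_countable (fun k : ℕ∞ => decide (k ≠ 0))).comp
    (hN.measurable_count _ (measurableSet_cell j))

lemma iIndepFun_occ (hℓ : 0 < ℓ) (hm : 0 < m) (hN : IsPoissonProcess P μ N) :
    iIndepFun (fun j => occ N ℓ m j) P := by
  classical
  exact (iIndepFun_count hN (fun j => measurableSet_cell (ℓ := ℓ) (m := m) j)
    (pairwise_disjoint_cell hℓ hm)).comp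
    (fun _ k => decide (k ≠ 0)) (fun _ => measurable_of_countable _)

/-- Events that depend on disjoint finite sets of independent Boolean variables are independent. -/
lemma real_inter_of_dependsOn {X : ℕ → Ω → Bool} (hX : ∀ i, Measurable (X i))
    (hind : iIndepFun X P) {S T : Finset ℕ} (hST : Disjoint S T) {A B : Set (ℕ → Bool)}
    (hA : ∀ x y : ℕ → Bool, (∀ i ∈ S, x i = y i) → x ∈ A → y ∈ A)
    (hB : ∀ x y : ℕ → Bool, (∀ i ∈ T, x i = y i) → x ∈ B → y ∈ B) :
    P.real ({ω | (fun i => X i ω) ∈ A} ∩ {ω | (fun i => X i ω) ∈ B})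
      = P.real {ω | (fun i => X i ω) ∈ A} * P.real {ω | (fun i => X i ω) ∈ B} := by
  -- Configurations on `U` are extended by `false`; the default is irrelevant because `C` depends
  -- only on the coordinates in `U`.
  have key : ∀ (U : Finset ℕ) (C : Set (ℕ → Bool)),
      (∀ x y : ℕ → Bool, (∀ i ∈ U, x i = y i) → x ∈ C → y ∈ C) →
      {ω | (fun i => X i ω) ∈ C} = (fun ω (i : U) => X i ω) ⁻¹'
        {z | (fun i => if h : i ∈ U then z ⟨i, h⟩ else false) ∈ C} := by
    intro U C hC
    ext ω
    refine ⟨hC _ _ fun i hi => by simp [hi], hC _ _ fun i hi => by simp [hi]⟩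
  have h := (hind.indepFun_finset S T hST hX).measure_inter_preimage_eq_mul _ _
    (Set.toFinite {z : S → Bool | (fun i => if h : i ∈ S then z ⟨i, h⟩ else false) ∈ A}).measurableSet
    (Set.toFinite {z : T → Bool | (fun i => if h : i ∈ T then z ⟨i, h⟩ else false) ∈ B}).measurableSet
  rw [key S A hA, key T B hB, measureReal_def, h, ENNReal.toReal_mul]
  rfl

end Occupation

/-! ### Tail bounds at a fixed mesh. -/

section Bounds

variable {Ω : Type*} [MeasurableSpace Ω] {P : Measure Ω} [IsProbabilityMeasure P]
  {μ : ℝ → ℝ} {N : Ω → Set ℝ} {ℓ : ℝ} {m : ℕ}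

/-- An upper bound for the tail of the first gap, from the grid of mesh `ℓ / m`. -/
lemma tail_le_exp (hℓ : 0 < ℓ) (hm : 0 < m)
    (hμint : ∀ t : ℝ, 0 < t → IntegrableOn μ (Set.Ioc 0 t)) (hN : IsPoissonProcess P μ N)
    {n : ℕ} {t : ℝ} (ht : grid ℓ m n ≤ t) :
    tail P N ℓ t ≤ Real.exp (-∑ k ∈ Finset.range n,
      (1 - Real.exp (-(intensity μ (cell ℓ m k)).toReal))
        * Real.exp (-(intensity μ (Set.Ico (grid ℓ m (k + 1)) (grid ℓ m (k + 1 + m)))).toReal)) := by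
  have hfin : ∀ u v, intensity μ (Set.Ico u v) ≠ ⊤ := fun u v =>
    intensity_ne_top hμint measurableSet_Ico Set.Ico_subset_Iio_self
  let E : ℕ → Set Ω := fun k => {ω | count N (cell ℓ m k) ω ≠ 0} ∩
    {ω | count N (Set.Ico (grid ℓ m (k + 1)) (grid ℓ m (k + 1 + m))) ω = 0}
  have hE : ∀ k, MeasurableSet (E k) := fun k =>
    (measurableSet_count_eq_zero hN (measurableSet_cell k)).compl.inter
      (measurableSet_count_eq_zero hN measurableSet_Ico)
  have hdisj : ∀ j k, j < k → k ≤ j + m → Disjoint (E j) (E k) := by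
    refine fun j k hjk hkj => Set.disjoint_left.mpr fun ω h1 h2 => h2.1 ?_
    exact (count_Ico_grid_eq_zero_iff hℓ hm).mp h1.2 k (by omega) (by omega)
  let C : ℕ → Set (ℕ → Bool) := fun k => {x | x k = true ∧ ∀ i, k + 1 ≤ i → i < k + 1 + m → x i = false}
  have hEC : ∀ k, E k = {ω | (fun i => occ N ℓ m i ω) ∈ C k} := by
    intro k
    ext ω
    simp only [E, C, Set.mem_inter_iff, Set.mem_ofPred_eq, count_Ico_grid_eq_zero_iff hℓ hm, occ,
      decide_eq_true_eq, decide_eq_false_iff_not, not_not]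
  -- For `j < k - m`, the event `E j` involves only the cells `j, …, j + m`, all before `k`, whereas
  -- `E k` involves the cells `k, …, k + m`.
  have hind : ∀ k, P.real ({ω | ∀ j < k - m, ω ∉ E j} ∩ E k)
      = P.real {ω | ∀ j < k - m, ω ∉ E j} * P.real (E k) := by
    intro k
    have h := real_inter_of_dependsOn (P := P) (X := fun j => occ N ℓ m j)
      (fun j => measurable_occ hN j)
      (iIndepFun_occ hℓ hm hN) (S := Finset.range k) (T := Finset.Ico k (k + 1 + m))
      (by rw [Finset.disjoint_left]; intro a; simp only [Finset.mem_range, Finset.mem_Ico]; omega)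
      (A := {x | ∀ j < k - m, x ∉ C j}) (B := C k) ?_ ?_
    · simp only [hEC]; exact h
    · intro x y hxy hx j hj hy
      refine hx j hj ⟨?_, fun i h1 h2 => ?_⟩
      · rw [hxy j (Finset.mem_range.mpr (by omega))]; exact hy.1
      · rw [hxy i (Finset.mem_range.mpr (by omega))]; exact hy.2 i h1 h2
    · intro x y hxy hx
      refine ⟨?_, fun i h1 h2 => ?_⟩
      · rw [← hxy k (Finset.mem_Ico.mpr (by omega))]; exact hx.1
      · rw [← hxy i (Finset.mem_Ico.mpr (by omega))]; exact hx.2 i h1 h2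
  have hPE : ∀ k, P.real (E k) = (1 - Real.exp (-(intensity μ (cell ℓ m k)).toReal))
      * Real.exp (-(intensity μ (Set.Ico (grid ℓ m (k + 1)) (grid ℓ m (k + 1 + m)))).toReal) :=
    fun k => real_count_ne_zero_inter_eq_zero hN (measurableSet_cell k) measurableSet_Ico
      (Set.disjoint_left.mpr fun x h1 h2 => absurd h1.2 (not_lt.mpr h2.1)) (hfin _ _) (hfin _ _)
  have hmain := real_forall_notMem_le_exp hE m hdisj hind n
  simp only [hPE] at hmain
  refine le_trans ?_ hmain
  refine ENNReal.toReal_mono (measure_ne_top _ _) (measure_mono_ae ?_)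
  filter_upwards [ae_finite_inter_Iio hμint hN] with ω hω hD j hj hEj
  have hocc : ∃ x ∈ N ω, x ∈ cell ℓ m j := by
    have := mt count_eq_zero_iff.mpr hEj.1
    push Not at this
    exact this
  have hemp := count_eq_zero_iff.mp hEj.2
  rw [grid_add_self hm] at hemp
  have h1 := firstGap_lt hℓ (hN.subset_Ioi ω) hω hocc hemp
  have h2 : grid ℓ m (j + 1) ≤ t := ((grid_strictMono hℓ hm).monotone hj).trans ht
  exact absurd (h1.trans_le (ENNReal.ofReal_le_ofReal h2)) (not_lt.mpr (le_of_lt hD))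

/-- The event that no run of `m - 1` empty cells starts in the block `[i ℓ, (i + 1) ℓ)`. -/
def noRun (N : Ω → Set ℝ) (ℓ : ℝ) (m i : ℕ) : Set Ω :=
  {ω | ∀ j, i * m ≤ j → j < (i + 1) * m →
    ∃ k, j ≤ k ∧ k < j + (m - 1) ∧ count N (cell ℓ m k) ω ≠ 0}

/-- A lower bound for the tail of the first gap, as a product over blocks of length `ℓ`. -/
lemma prod_noRun_le_tail (hℓ : 0 < ℓ) (hm : 0 < m) (hN : IsPoissonProcess P μ N)
    {n : ℕ} (hn : 0 < n) {t : ℝ} (ht : t < ℓ * n) :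
    ∏ i ∈ Finset.range (n + 1), P.real (noRun N ℓ m i) ≤ tail P N ℓ t := by
  -- Runs that start in block `n` may extend into block `n + 1`, so `n + 2` blocks of cells are
  -- needed.
  let K := (n + 2) * m
  let A : ℕ → Set (Fin K → Bool) := fun i => {x | i < n + 1 → ∀ j, i * m ≤ j → j < (i + 1) * m →
    ∃ k : Fin K, j ≤ k ∧ k < j + (m - 1) ∧ x k = true}
  have hA : ∀ i, IsUpperSet (A i) := by
    intro i x y hxy hx hi j h1 h2
    obtain ⟨k, hk1, hk2, hk⟩ := hx hi j h1 h2
    exact ⟨k, hk1, hk2, by have := hxy k; rw [hk] at this; exact top_le_iff.mp this⟩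
  have hNA : ∀ i < n + 1, noRun N ℓ m i
      = {ω | (fun j : Fin K => occ N ℓ m j ω) ∈ A i} := by
    intro i hi
    ext ω
    simp only [noRun, A, Set.mem_ofPred_eq, occ, decide_eq_true_eq]
    constructor
    · intro h _ j h1 h2
      obtain ⟨k, hk1, hk2, hk⟩ := h j h1 h2
      have : (i + 2) * m ≤ (n + 2) * m := Nat.mul_le_mul_right m (by omega)
      have e1 : (i + 2) * m = i * m + 2 * m := by ring
      have e2 : (i + 1) * m = i * m + m := by ring
      exact ⟨⟨k, show k < (n + 2) * m by omega⟩, hk1, hk2, hk⟩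
    · intro h j h1 h2
      obtain ⟨k, hk1, hk2, hk⟩ := h hi j h1 h2
      exact ⟨k, hk1, hk2, hk⟩
  have hH := harris (P := P) (X := fun j : Fin K => occ N ℓ m j) (fun j => measurable_occ hN j)
    ((iIndepFun_occ hℓ hm hN).precomp (g := fun j : Fin K => (j : ℕ)) Fin.val_injective) hA (n + 1)
  rw [Finset.prod_congr rfl fun i hi => by rw [hNA i (Finset.mem_range.mp hi)]]
  refine hH.trans (measureReal_mono fun ω hω => ?_)
  have hω' : ∀ i < n + 1, ω ∈ noRun N ℓ m i := fun i hi => by rw [hNA i hi]; exact hω i hi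
  by_contra hD
  have hD' : firstGap ℓ (N ω) ≤ ENNReal.ofReal t := not_lt.mp hD
  have hpos : 0 < ℓ * n := mul_pos hℓ (by exact_mod_cast hn)
  obtain ⟨T, hT0, hTn, hgap⟩ := exists_gap_of_firstGap_lt hℓ
    (hD'.trans_lt ((ENNReal.ofReal_lt_ofReal_iff hpos).mpr ht))
  obtain ⟨j, hj⟩ := exists_mem_cell (m := m) hℓ hm hT0
  have hjn : j < n * m := by
    rw [← (grid_strictMono hℓ hm).lt_iff_lt, grid_mul hm]; exact hj.1.trans_lt hTn
  -- The gap starts at `T` in cell `j`, so the empty run starts at cell `j + 1`. This may already be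
  -- the first cell of block `n`, which is why the product has `n + 1` factors.
  have hi : (j + 1) / m < n + 1 := by
    rw [Nat.div_lt_iff_lt_mul hm]
    have : (n + 1) * m = n * m + m := by ring
    omega
  obtain ⟨k, hk1, hk2, hk⟩ := hω' _ hi (j + 1) (Nat.div_mul_le_self _ _)
    (by rw [mul_comm]; exact Nat.lt_mul_div_succ _ hm)
  have hocc : ∃ x ∈ N ω, x ∈ cell ℓ m k := by
    have := mt count_eq_zero_iff.mpr hk
    push Not at this
    exact this
  obtain ⟨x, hx, hxk⟩ := hocc
  have hx' := cell_subset_Ico (a := j + 1) (b := j + m) hℓ hm hk1 (by omega) hxk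
  rw [grid_add_self hm] at hx'
  have := hgap x hx (hj.2.trans_le hx'.1)
  linarith [hx'.2, hj.1]

/-- The probability that a long run of empty cells starts in a given block. -/
lemma real_compl_noRun_le (hℓ : 0 < ℓ) (hm : 0 < m)
    (hμint : ∀ t : ℝ, 0 < t → IntegrableOn μ (Set.Ioc 0 t)) (hN : IsPoissonProcess P μ N) (i : ℕ) :
    P.real (noRun N ℓ m i)ᶜ ≤
      Real.exp (-(intensity μ (Set.Ico (grid ℓ m (i * m)) (grid ℓ m (i * m + (m - 1))))).toReal)
      + ∑ k ∈ Finset.range m, (1 - Real.exp (-(intensity μ (cell ℓ m (i * m + k))).toReal))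
        * Real.exp (-(intensity μ (Set.Ico (grid ℓ m (i * m + k + 1))
          (grid ℓ m (i * m + k + 1 + (m - 1))))).toReal) := by
  have hfin : ∀ u v, intensity μ (Set.Ico u v) ≠ ⊤ := fun u v =>
    intensity_ne_top hμint measurableSet_Ico Set.Ico_subset_Iio_self
  let R : ℕ → Set Ω := fun j =>
    {ω | count N (Set.Ico (grid ℓ m j) (grid ℓ m (j + (m - 1)))) ω = 0}
  let E : ℕ → Set Ω := fun j => {ω | count N (cell ℓ m j) ω ≠ 0} ∩ R (j + 1)
  have hR : P.real (R (i * m)) = Real.exp (-(intensity μ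
      (Set.Ico (grid ℓ m (i * m)) (grid ℓ m (i * m + (m - 1))))).toReal) :=
    real_count_eq_zero hN measurableSet_Ico (hfin _ _)
  have hPE : ∀ k, P.real (E k) = (1 - Real.exp (-(intensity μ (cell ℓ m k)).toReal))
      * Real.exp (-(intensity μ (Set.Ico (grid ℓ m (k + 1)) (grid ℓ m (k + 1 + (m - 1))))).toReal) :=
    fun k => real_count_ne_zero_inter_eq_zero hN (measurableSet_cell k) measurableSet_Ico
      (Set.disjoint_left.mpr fun x h1 h2 => absurd h1.2 (not_lt.mpr h2.1)) (hfin _ _) (hfin _ _)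
  simp only [← hPE, ← hR]
  have hsub : (noRun N ℓ m i)ᶜ ⊆ R (i * m) ∪ ⋃ k ∈ Finset.range m, E (i * m + k) := by
    intro ω hω
    have hex : ∃ j, i * m ≤ j ∧ j < (i + 1) * m ∧ ω ∈ R j := by
      simp only [noRun, Set.mem_compl_iff, Set.mem_ofPred_eq] at hω
      push Not at hω
      obtain ⟨j, h1, h2, h3⟩ := hω
      exact ⟨j, h1, h2, (count_Ico_grid_eq_zero_iff hℓ hm).mpr h3⟩
    classical
    -- The first run in the block either starts at its left end or is preceded by an occupied cell,
    -- since otherwise a run would start one cell earlier.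
    obtain ⟨h1, h2, h3⟩ := Nat.find_spec hex
    have hmin := fun j hj => Nat.find_min hex (m := j) hj
    generalize Nat.find hex = j at h1 h2 h3 hmin
    rcases h1.eq_or_lt with h | h
    · left; rw [h]; exact h3
    · right
      have e2 : (i + 1) * m = i * m + m := by ring
      obtain ⟨k, rfl⟩ : ∃ k, j = i * m + k + 1 := ⟨j - 1 - i * m, by omega⟩
      simp only [Set.mem_iUnion, Finset.mem_range]
      refine ⟨k, by omega, fun h0 => hmin (i * m + k) (by omega) ⟨by omega, by omega, ?_⟩, h3⟩
      refine (count_Ico_grid_eq_zero_iff hℓ hm).mpr fun c hc1 hc2 => ?_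
      rcases hc1.eq_or_lt with rfl | hc
      · exact h0
      · exact (count_Ico_grid_eq_zero_iff hℓ hm).mp h3 c hc (by omega)
  refine (measureReal_mono hsub).trans ((measureReal_union_le _ _).trans ?_)
  gcongr
  exact measureReal_biUnion_finset_le _ _

/-- The probability that no long run starts in a given block is bounded below, uniformly in the
mesh. -/
lemma exists_le_real_noRun (hℓ : 0 < ℓ)
    (hμpos : ∀ᵐ t ∂(volume.restrict (Set.Ioi (0 : ℝ))), 0 < μ t)
    (hμint : ∀ t : ℝ, 0 < t → IntegrableOn μ (Set.Ioc 0 t)) (hN : IsPoissonProcess P μ N) (i : ℕ) :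
    ∃ c > 0, ∀ m : ℕ, 2 ≤ m → c ≤ P.real (noRun N ℓ m i) := by
  -- For `m ≥ 2` a run has length `ℓ - ℓ / m ≥ ℓ / 2`, hence contains a whole cell of mesh `ℓ / 4`.
  -- Occupation of the eight such cells in blocks `i` and `i + 1` therefore rules out every run,
  -- whatever `m` is.
  have h4 : 0 < 4 := by norm_num
  refine ⟨∏ h ∈ Finset.Ico (4 * i) (4 * i + 8),
    P.real {ω | count N (cell ℓ 4 h) ω ≠ 0}, Finset.prod_pos fun h _ => ?_, fun m hm2 => ?_⟩
  · rw [real_count_ne_zero hN (measurableSet_cell h)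
      (intensity_ne_top hμint measurableSet_Ico Set.Ico_subset_Iio_self), sub_pos,
      Real.exp_lt_one_iff, neg_lt_zero]
    exact intensity_Ico_pos hμpos hμint (grid_nonneg hℓ h) (grid_strictMono hℓ h4 h.lt_succ_self)
  · have hm : 0 < m := by omega
    have hind := (iIndepFun_count hN (fun j => measurableSet_cell (ℓ := ℓ) (m := 4) j)
      (pairwise_disjoint_cell hℓ h4)).measure_inter_preimage_eq_mul
      (Finset.Ico (4 * i) (4 * i + 8)) (sets := fun _ => {0}ᶜ)
      (fun _ _ => (measurableSet_singleton 0).compl)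
    have hprod : ∏ h ∈ Finset.Ico (4 * i) (4 * i + 8), P.real {ω | count N (cell ℓ 4 h) ω ≠ 0}
        = P.real (⋂ h ∈ Finset.Ico (4 * i) (4 * i + 8), count N (cell ℓ 4 h) ⁻¹' {0}ᶜ) := by
      rw [measureReal_def, hind, ENNReal.toReal_prod]; rfl
    rw [hprod]
    refine measureReal_mono fun ω hω j hj1 hj2 => ?_
    simp only [Set.mem_iInter, Finset.mem_Ico] at hω
    have hm' : (2 : ℝ) ≤ m := by exact_mod_cast hm2
    set x := grid ℓ m j with hx
    have hx0 : 0 ≤ x := grid_nonneg hℓ j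
    have hxlo : ℓ * i ≤ x := by
      rw [← grid_mul (ℓ := ℓ) hm]; exact (grid_strictMono hℓ hm).monotone hj1
    have hxhi : x < ℓ * (i + 1) := by
      have := grid_strictMono hℓ hm hj2
      rwa [grid_mul hm, Nat.cast_add, Nat.cast_one] at this
    have hc1 := Nat.le_ceil (4 * x / ℓ)
    have hc2 := Nat.ceil_lt_add_one (show 0 ≤ 4 * x / ℓ by positivity)
    -- Cell `h` is the first cell of mesh `ℓ / 4` starting at or after `x`; it ends before `x + ℓ /
    -- 2`.
    set h := ⌈4 * x / ℓ⌉₊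
    rw [div_le_iff₀ hℓ] at hc1
    rw [← sub_lt_iff_lt_add, lt_div_iff₀ hℓ] at hc2
    have hlo : 4 * i ≤ h := by
      have : (4 * i : ℝ) ≤ h := by
        refine le_of_mul_le_mul_right ?_ hℓ
        linarith
      exact_mod_cast this
    have hhi : h < 4 * i + 8 := by
      have : (h : ℝ) < 4 * i + 8 := by
        refine lt_of_mul_lt_mul_right ?_ hℓ.le
        linarith
      exact_mod_cast this
    have hocc : ∃ y ∈ N ω, y ∈ cell ℓ 4 h := by
      have := mt count_eq_zero_iff.mpr (hω h ⟨hlo, hhi⟩)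
      push Not at this
      exact this
    obtain ⟨y, hyN, hy⟩ := hocc
    have hend : grid ℓ m (j + (m - 1)) = x + ℓ - ℓ / m := by
      have h1 := grid_succ (ℓ := ℓ) (m := m) (j + (m - 1))
      rw [show j + (m - 1) + 1 = j + m by omega, grid_add_self hm] at h1
      linarith
    have hdiv : ℓ / m ≤ ℓ / 2 := by gcongr
    have hyI : y ∈ Set.Ico (grid ℓ m j) (grid ℓ m (j + (m - 1))) := by
      have hy1 := hy.1
      have hy2 := hy.2
      rw [grid_succ] at hy2
      unfold grid at hy1 hy2
      push_cast at hy1 hy2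
      rw [hend]
      constructor <;> linarith
    obtain ⟨k, hk1, hk2, hk⟩ := exists_mem_cell_of_mem_Ico hℓ hm hyI
    exact ⟨k, hk1, hk2, fun h0 => count_eq_zero_iff.mp h0 y hyN hk⟩

end Bounds

/-! ### Bounds for one block, given bounds on the rate there. -/

section Blocks

variable {Ω : Type*} [MeasurableSpace Ω] {P : Measure Ω} [IsProbabilityMeasure P]
  {μ : ℝ → ℝ} {N : Ω → Set ℝ} {ℓ : ℝ} {m : ℕ}

/-- The sum over the cells of the block `[i ℓ, (i + 1) ℓ)` of the probabilities that the cell is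
occupied and followed by an empty interval of length `ℓ`. -/
def blockSum (μ : ℝ → ℝ) (ℓ : ℝ) (m i : ℕ) : ℝ :=
  ∑ k ∈ Finset.range m, (1 - Real.exp (-(intensity μ (cell ℓ m (i * m + k))).toReal))
    * Real.exp (-(intensity μ (Set.Ico (grid ℓ m (i * m + k + 1))
      (grid ℓ m (i * m + k + 1 + m)))).toReal)

lemma blockSum_nonneg (i : ℕ) : 0 ≤ blockSum μ ℓ m i :=
  Finset.sum_nonneg fun _ _ => mul_nonneg
    (sub_nonneg.mpr (Real.exp_le_one_iff.mpr (neg_nonpos.mpr ENNReal.toReal_nonneg)))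
    (Real.exp_pos _).le

lemma sum_range_mul_eq (f : ℕ → ℝ) (n m : ℕ) :
    ∑ k ∈ Finset.range (n * m), f k
      = ∑ i ∈ Finset.range n, ∑ k ∈ Finset.range m, f (i * m + k) := by
  induction n with
  | zero => simp
  | succ n ih => rw [Nat.succ_mul, Finset.sum_range_add, ih, Finset.sum_range_succ]

lemma tail_le_exp_blockSum (hℓ : 0 < ℓ) (hm : 0 < m)
    (hμint : ∀ t : ℝ, 0 < t → IntegrableOn μ (Set.Ioc 0 t)) (hN : IsPoissonProcess P μ N)
    {n : ℕ} {t : ℝ} (ht : ℓ * n ≤ t) :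
    tail P N ℓ t ≤ Real.exp (-∑ i ∈ Finset.range n, blockSum μ ℓ m i) := by
  have h := tail_le_exp (n := n * m) (t := t) hℓ hm hμint hN (by rwa [grid_mul hm])
  rwa [sum_range_mul_eq] at h

lemma grid_add_sub (hm : 0 < m) (a : ℕ) : grid ℓ m (a + (m - 1)) - grid ℓ m a = ℓ - ℓ / m := by
  have h1 := grid_succ (ℓ := ℓ) (m := m) (a + (m - 1))
  rw [show a + (m - 1) + 1 = a + m by omega, grid_add_self hm] at h1
  linarith

/-- The lower bound on the rate serves the occupied cell and the upper bound serves the empty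
interval. A cell of the block and the interval of length `ℓ` after it stay within a window of length
`2 * ℓ`. -/
lemma le_blockSum (hℓ : 0 < ℓ) (hm : 0 < m)
    (hμint : ∀ t : ℝ, 0 < t → IntegrableOn μ (Set.Ioc 0 t)) {i : ℕ} (hi : 0 < i) {lo hi' : ℝ}
    (hlo : 0 ≤ lo) (h : ∀ x ∈ Set.Icc (ℓ * i) (ℓ * i + 2 * ℓ), lo ≤ μ x ∧ μ x ≤ hi') :
    m * (1 - Real.exp (-(lo * ℓ / m))) * Real.exp (-(hi' * ℓ)) ≤ blockSum μ ℓ m i := by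
  have hmono := (grid_strictMono hℓ hm).monotone
  have hpos : 0 < ℓ * i := mul_pos hℓ (by exact_mod_cast hi)
  have hi0 : 0 ≤ hi' := hlo.trans ((h (ℓ * i) ⟨le_rfl, by linarith⟩).1.trans
    (h (ℓ * i) ⟨le_rfl, by linarith⟩).2)
  have hleft : ∀ k, ℓ * i ≤ grid ℓ m (i * m + k) := fun k => by
    rw [← grid_mul (ℓ := ℓ) hm]; exact hmono (by omega)
  have hright : grid ℓ m (i * m + m + m) = ℓ * i + 2 * ℓ := by
    rw [grid_add_self hm, grid_add_self hm, grid_mul hm]; ring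
  rw [mul_assoc, blockSum]
  refine le_of_eq_of_le (b := (Finset.range m).card • ((1 - Real.exp (-(lo * ℓ / m)))
    * Real.exp (-(hi' * ℓ)))) (by rw [Finset.card_range, nsmul_eq_mul]) ?_
  refine Finset.card_nsmul_le_sum _ _ _ fun k hk => ?_
  have hk := Finset.mem_range.mp hk
  have h1 : lo * ℓ / m ≤ (intensity μ (cell ℓ m (i * m + k))).toReal := by
    have := le_intensity_Ico (c := lo) hμint (hpos.trans_le (hleft k))
      (hmono (Nat.le_succ (i * m + k)))
      (fun x hx => (h x ⟨(hleft k).trans hx.1,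
        hx.2.le.trans ((hmono (by omega)).trans hright.le)⟩).1)
    rw [grid_succ, add_sub_cancel_left] at this
    rw [mul_div_assoc, cell, grid_succ]; exact this
  have h2 : (intensity μ (Set.Ico (grid ℓ m (i * m + k + 1))
      (grid ℓ m (i * m + k + 1 + m)))).toReal ≤ hi' * ℓ := by
    have := intensity_Ico_le (c := hi') (hpos.trans_le (hleft (k + 1)))
      (hmono (show i * m + (k + 1) ≤ i * m + (k + 1) + m by omega)) hi0
      (fun x hx => (h x ⟨(hleft (k + 1)).trans hx.1,
        hx.2.le.trans ((hmono (by omega)).trans hright.le)⟩).2)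
    rw [grid_add_self hm, add_sub_cancel_left] at this
    rw [show i * m + k + 1 = i * m + (k + 1) by omega, grid_add_self hm]; exact this
  have h3 : 0 ≤ lo * ℓ / m := by positivity
  refine mul_le_mul ?_ (Real.exp_le_exp.mpr (neg_le_neg h2)) (Real.exp_pos _).le ?_
  · exact sub_le_sub_left (Real.exp_le_exp.mpr (neg_le_neg h1)) 1
  · exact sub_nonneg.mpr (Real.exp_le_one_iff.mpr (neg_nonpos.mpr ENNReal.toReal_nonneg))

/-- In the factor `1 + hi' * ℓ`, the `1` accounts for a run at the left end of the block, and `hi' *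
ℓ` sums the occupation probabilities of the cells that can precede a run. -/
lemma le_real_noRun (hℓ : 0 < ℓ) (hm : 0 < m)
    (hμint : ∀ t : ℝ, 0 < t → IntegrableOn μ (Set.Ioc 0 t)) (hN : IsPoissonProcess P μ N)
    {i : ℕ} (hi : 0 < i) {lo hi' : ℝ}
    (hlo : 0 ≤ lo) (h : ∀ x ∈ Set.Icc (ℓ * i) (ℓ * i + 2 * ℓ), lo ≤ μ x ∧ μ x ≤ hi') :
    1 - (1 + hi' * ℓ) * Real.exp (-(lo * (ℓ - ℓ / m))) ≤ P.real (noRun N ℓ m i) := by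
  have hmono := (grid_strictMono hℓ hm).monotone
  have hpos : 0 < ℓ * i := mul_pos hℓ (by exact_mod_cast hi)
  have hm' : (0 : ℝ) < m := by exact_mod_cast hm
  have hi0 : 0 ≤ hi' := hlo.trans ((h (ℓ * i) ⟨le_rfl, by linarith⟩).1.trans
    (h (ℓ * i) ⟨le_rfl, by linarith⟩).2)
  have hleft : ∀ k, ℓ * i ≤ grid ℓ m (i * m + k) := fun k => by
    rw [← grid_mul (ℓ := ℓ) hm]; exact hmono (by omega)
  have hright : grid ℓ m (i * m + m + m) = ℓ * i + 2 * ℓ := by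
    rw [grid_add_self hm, grid_add_self hm, grid_mul hm]; ring
  have hrun : ∀ k ≤ m, Real.exp (-(intensity μ (Set.Ico (grid ℓ m (i * m + k))
      (grid ℓ m (i * m + k + (m - 1))))).toReal) ≤ Real.exp (-(lo * (ℓ - ℓ / m))) := by
    intro k hk
    refine Real.exp_le_exp.mpr (neg_le_neg ?_)
    rw [← grid_add_sub hm (i * m + k)]
    exact le_intensity_Ico hμint (hpos.trans_le (hleft k)) (hmono (by omega))
      (fun x hx => (h x ⟨(hleft k).trans hx.1,
        hx.2.le.trans ((hmono (by omega)).trans hright.le)⟩).1)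
  have hcell : ∀ k < m, 1 - Real.exp (-(intensity μ (cell ℓ m (i * m + k))).toReal)
      ≤ hi' * (ℓ / m) := by
    intro k hk
    have := intensity_Ico_le (c := hi') (hpos.trans_le (hleft k))
      (hmono (Nat.le_succ (i * m + k))) hi0
      (fun x hx => (h x ⟨(hleft k).trans hx.1,
        hx.2.le.trans ((hmono (by omega)).trans hright.le)⟩).2)
    rw [grid_succ, add_sub_cancel_left] at this
    have h2 := Real.add_one_le_exp (-(intensity μ (cell ℓ m (i * m + k))).toReal)
    unfold cell at h2 ⊢
    rw [grid_succ] at h2 ⊢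
    linarith
  have hsum : ∑ k ∈ Finset.range m, (1 - Real.exp (-(intensity μ (cell ℓ m (i * m + k))).toReal))
        * Real.exp (-(intensity μ (Set.Ico (grid ℓ m (i * m + k + 1))
          (grid ℓ m (i * m + k + 1 + (m - 1))))).toReal)
      ≤ hi' * ℓ * Real.exp (-(lo * (ℓ - ℓ / m))) := by
    have h1 : hi' * ℓ * Real.exp (-(lo * (ℓ - ℓ / m)))
        = (Finset.range m).card • (hi' * (ℓ / m) * Real.exp (-(lo * (ℓ - ℓ / m)))) := by
      rw [Finset.card_range, nsmul_eq_mul]; field_simp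
    rw [h1]
    refine Finset.sum_le_card_nsmul _ _ _ fun k hk => ?_
    have hk := Finset.mem_range.mp hk
    exact mul_le_mul (hcell k hk) (hrun (k + 1) hk) (Real.exp_pos _).le (by positivity)
  have h0 := real_compl_noRun_le hℓ hm hμint hN i
  have h1 := hrun 0 (Nat.zero_le _)
  -- Subadditivity suffices here, so `noRun` need not be shown measurable.
  have h2 : 1 ≤ P.real (noRun N ℓ m i) + P.real (noRun N ℓ m i)ᶜ := by
    have := measureReal_union_le (μ := P) (noRun N ℓ m i) (noRun N ℓ m i)ᶜ
    rwa [Set.union_compl_self, probReal_univ] at this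
  simp only [add_zero] at h1
  linarith

end Blocks

/-! ### Slowly varying rates: comparing the block bounds with the hazard. -/

section Asymptotics

/-- The exponential absorbs an error `η` of the rate inside `exp (-(ℓ * μ))`. The square absorbs two
relative errors: that of the rate as a prefactor, and that of the mesh limit or of the ratio of `H'`
to the hazard. -/
lemma exists_tolerance (ℓ : ℝ) {κ : ℝ} (hκ : 0 < κ) : ∃ η : ℝ, 0 < η ∧ η < 1 ∧
    (1 + η) ^ 2 * Real.exp (ℓ * η) < 1 + κ ∧ 1 - κ < (1 - η) ^ 2 * Real.exp (-(ℓ * η)) := by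
  have h1 : Tendsto (fun η : ℝ => (1 + η) ^ 2 * Real.exp (ℓ * η)) (𝓝[>] 0) (𝓝 1) := by
    have : Continuous fun η : ℝ => (1 + η) ^ 2 * Real.exp (ℓ * η) := by fun_prop
    simpa using (this.tendsto 0).mono_left nhdsWithin_le_nhds
  have h2 : Tendsto (fun η : ℝ => (1 - η) ^ 2 * Real.exp (-(ℓ * η))) (𝓝[>] 0) (𝓝 1) := by
    have : Continuous fun η : ℝ => (1 - η) ^ 2 * Real.exp (-(ℓ * η)) := by fun_prop
    simpa using (this.tendsto 0).mono_left nhdsWithin_le_nhds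
  have h3 : ∀ᶠ η : ℝ in 𝓝[>] 0, η < 1 :=
    nhdsWithin_le_nhds (eventually_lt_nhds one_pos)
  obtain ⟨η, ⟨⟨ha, hb⟩, hc⟩, hd⟩ := (((h1.eventually_lt_const (show 1 < 1 + κ by linarith)).and
    (h2.eventually_const_lt (show 1 - κ < 1 by linarith))).and h3).and
    self_mem_nhdsWithin |>.exists
  exact ⟨η, hd, hc, ha, hb⟩

lemma tendsto_nat_mul_one_sub_exp {c : ℝ} (hc : 0 ≤ c) :
    Tendsto (fun m : ℕ => (m : ℝ) * (1 - Real.exp (-(c / m)))) atTop (𝓝 c) := by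
  have h1 : Tendsto (fun m : ℕ => c / (1 + c / (m : ℝ))) atTop (𝓝 c) := by
    have : Tendsto (fun m : ℕ => c / (m : ℝ)) atTop (𝓝 0) :=
      tendsto_const_nhds.div_atTop tendsto_natCast_atTop_atTop
    have h2 : Tendsto (fun m : ℕ => 1 + c / (m : ℝ)) atTop (𝓝 1) := by
      simpa using this.const_add 1
    have h3 := (tendsto_const_nhds (x := c)).div h2 one_ne_zero
    rwa [div_one] at h3
  refine tendsto_of_tendsto_of_tendsto_of_le_of_le' h1 tendsto_const_nhds ?_ ?_
  all_goals
    filter_upwards [eventually_gt_atTop 0] with m hm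
    have hm' : (0 : ℝ) < m := by exact_mod_cast hm
    have hx : 0 ≤ c / m := by positivity
    have hmx : m * (c / m) = c := by field_simp
  · have h2 : Real.exp (-(c / m)) ≤ 1 / (1 + c / m) := by
      rw [Real.exp_neg, ← one_div]
      exact one_div_le_one_div_of_le (by linarith) (by linarith [Real.add_one_le_exp (c / m)])
    have h3 : c / (1 + c / m) = m * (1 - 1 / (1 + c / m)) := by
      have : (1 + c / m : ℝ) ≠ 0 := by positivity
      field_simp
      ring
    rw [h3]
    gcongr
  · calc (m : ℝ) * (1 - Real.exp (-(c / m))) ≤ m * (c / m) := by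
          gcongr; linarith [Real.add_one_le_exp (-(c / m))]
      _ = c := hmx

/-- A rate function that tends to infinity and varies slowly on the scale `ℓ`. -/
structure SlowRate (μ : ℝ → ℝ) (ℓ : ℝ) : Prop where
  tendsto : Tendsto μ atTop atTop
  slow : ∀ η > 0, ∀ᶠ s in atTop, ∀ x ∈ Set.Icc s (s + 2 * ℓ), |μ x - μ s| ≤ η

variable {Ω : Type*} [MeasurableSpace Ω] {P : Measure Ω} [IsProbabilityMeasure P]
  {μ : ℝ → ℝ} {N : Ω → Set ℝ} {ℓ : ℝ}

lemma tendsto_mul_natCast (hℓ : 0 < ℓ) : Tendsto (fun i : ℕ => ℓ * (i : ℝ)) atTop atTop :=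
  tendsto_natCast_atTop_atTop.const_mul_atTop hℓ

/-- The integral of the hazard rate over a block, approximately. -/
def blockHazard (μ : ℝ → ℝ) (ℓ : ℝ) (i : ℕ) : ℝ :=
  ℓ * (μ (ℓ * i) * Real.exp (-(ℓ * μ (ℓ * i))))

lemma SlowRate.tendsto_blockHazard (h : SlowRate μ ℓ) (hℓ : 0 < ℓ) :
    Tendsto (blockHazard μ ℓ) atTop (𝓝 0) := by
  have h1 : Tendsto (fun i : ℕ => ℓ * μ (ℓ * i)) atTop atTop :=
    (h.tendsto.comp (tendsto_mul_natCast hℓ)).const_mul_atTop hℓ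
  have h2 := (Real.tendsto_pow_mul_exp_neg_atTop_nhds_zero 1).comp h1
  refine h2.congr fun i => ?_
  simp only [blockHazard, Function.comp, pow_one]
  ring

lemma SlowRate.blockHazard_pos (h : SlowRate μ ℓ) (hℓ : 0 < ℓ) :
    ∀ᶠ i in atTop, 0 < blockHazard μ ℓ i := by
  filter_upwards [(h.tendsto.comp (tendsto_mul_natCast hℓ)).eventually_gt_atTop 0] with i hi
  have hi : 0 < μ (ℓ * i) := hi
  unfold blockHazard
  positivity

/-- Bounds for the rate on a window, with multiplicative errors. -/
lemma SlowRate.eventually_bounds (h : SlowRate μ ℓ) (hℓ : 0 < ℓ) {η : ℝ} (hη : 0 < η) (B : ℝ) :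
    ∀ᶠ i : ℕ in atTop, 0 < i ∧ B ≤ μ (ℓ * i) ∧ ∀ x ∈ Set.Icc (ℓ * i) (ℓ * i + 2 * ℓ),
      μ (ℓ * i) - η ≤ μ x ∧ μ x ≤ μ (ℓ * i) + η := by
  filter_upwards [eventually_gt_atTop 0,
    (h.tendsto.comp (tendsto_mul_natCast hℓ)).eventually_ge_atTop B,
    (tendsto_mul_natCast hℓ).eventually (h.slow η hη)] with i h1 h2 h3
  refine ⟨h1, h2, fun x hx => ?_⟩
  have := abs_le.mp (h3 x hx)
  constructor <;> linarith [this.1, this.2]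

lemma SlowRate.eventually_le_blockSum (h : SlowRate μ ℓ) (hℓ : 0 < ℓ)
    (hμint : ∀ t : ℝ, 0 < t → IntegrableOn μ (Set.Ioc 0 t)) {κ : ℝ} (hκ : 0 < κ) :
    ∀ᶠ i in atTop, ∀ᶠ m in atTop, (1 - κ) * blockHazard μ ℓ i ≤ blockSum μ ℓ m i := by
  obtain ⟨η, hη0, hη1, -, hη⟩ := exists_tolerance ℓ hκ
  filter_upwards [h.eventually_bounds hℓ hη0 1] with i ⟨hi, hB, hw⟩
  rw [blockHazard]
  set M := μ (ℓ * i)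
  have hlo : 0 < M - η := by linarith
  have hlim := tendsto_nat_mul_one_sub_exp (c := (M - η) * ℓ) (by positivity)
  have hlt : (1 - η) * ((M - η) * ℓ) < (M - η) * ℓ := by
    have : 0 < (M - η) * ℓ := by positivity
    nlinarith
  filter_upwards [hlim.eventually_const_lt hlt, eventually_gt_atTop 0] with m hm hm0
  refine le_trans ?_ (le_blockSum hℓ hm0 hμint hi hlo.le hw)
  have h1 : (1 - η) * M ≤ M - η := by nlinarith
  have hM : 0 < M := by linarith
  have h2 : Real.exp (-((M + η) * ℓ)) = Real.exp (-(ℓ * η)) * Real.exp (-(ℓ * M)) := by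
    rw [← Real.exp_add]; ring_nf
  calc (1 - κ) * (ℓ * (M * Real.exp (-(ℓ * M))))
      ≤ ((1 - η) ^ 2 * Real.exp (-(ℓ * η))) * (ℓ * (M * Real.exp (-(ℓ * M)))) := by gcongr
    _ = ((1 - η) * (((1 - η) * M) * ℓ)) * Real.exp (-((M + η) * ℓ)) := by rw [h2]; ring
    _ ≤ ((1 - η) * ((M - η) * ℓ)) * Real.exp (-((M + η) * ℓ)) := by
        have : 0 ≤ 1 - η := by linarith
        gcongr
    _ ≤ _ := by gcongr

lemma SlowRate.eventually_le_real_noRun (h : SlowRate μ ℓ) (hℓ : 0 < ℓ)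
    (hμint : ∀ t : ℝ, 0 < t → IntegrableOn μ (Set.Ioc 0 t)) (hN : IsPoissonProcess P μ N)
    {κ : ℝ} (hκ : 0 < κ) :
    ∀ᶠ i in atTop, ∀ᶠ m in atTop,
      1 - (1 + κ) * blockHazard μ ℓ i ≤ P.real (noRun N ℓ m i) := by
  obtain ⟨η, hη0, hη1, hη, -⟩ := exists_tolerance ℓ hκ
  -- The second threshold gives `1 + (M + η) * ℓ ≤ (1 + η) * M * ℓ`, so a run at the left end of a
  -- block costs only a relative error.
  filter_upwards [h.eventually_bounds hℓ hη0 (max 1 ((1 / ℓ + η) / η))] with i ⟨hi, hB, hw⟩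
  rw [blockHazard]
  set M := μ (ℓ * i)
  have hM1 : 1 ≤ M := (le_max_left _ _).trans hB
  have hM2 : 1 / ℓ + η ≤ M * η := (div_le_iff₀ hη0).mp ((le_max_right _ _).trans hB)
  have hlo : 0 < M - η := by linarith
  have hlim : Tendsto (fun m : ℕ => Real.exp (-((M - η) * (ℓ - ℓ / m)))) atTop
      (𝓝 (Real.exp (-((M - η) * (ℓ - 0))))) := by
    have : Tendsto (fun m : ℕ => ℓ / (m : ℝ)) atTop (𝓝 0) :=
      tendsto_const_nhds.div_atTop tendsto_natCast_atTop_atTop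
    exact (Real.continuous_exp.tendsto _).comp ((tendsto_const_nhds.mul
      (tendsto_const_nhds.sub this)).neg)
  have hlt : Real.exp (-((M - η) * (ℓ - 0))) < (1 + η) * Real.exp (-((M - η) * ℓ)) := by
    rw [sub_zero]
    have := Real.exp_pos (-((M - η) * ℓ))
    nlinarith
  filter_upwards [hlim.eventually_lt_const hlt, eventually_gt_atTop 0] with m hm hm0
  refine le_trans ?_ (le_real_noRun hℓ hm0 hμint hN hi hlo.le hw)
  have hM : 0 < M := by linarith
  have h1 : 1 + (M + η) * ℓ ≤ (1 + η) * M * ℓ := by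
    have h3 : (1 / ℓ + η) * ℓ ≤ M * η * ℓ := mul_le_mul_of_nonneg_right hM2 hℓ.le
    have h4 : (1 / ℓ + η) * ℓ = 1 + η * ℓ := by field_simp
    linarith
  have h2 : Real.exp (-((M - η) * ℓ)) = Real.exp (ℓ * η) * Real.exp (-(ℓ * M)) := by
    rw [← Real.exp_add]; ring_nf
  refine sub_le_sub_left ?_ 1
  calc (1 + (M + η) * ℓ) * Real.exp (-((M - η) * (ℓ - ℓ / m)))
      ≤ ((1 + η) * M * ℓ) * ((1 + η) * Real.exp (-((M - η) * ℓ))) :=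
        mul_le_mul h1 hm.le (Real.exp_pos _).le (by positivity)
    _ = ((1 + η) ^ 2 * Real.exp (ℓ * η)) * (ℓ * (M * Real.exp (-(ℓ * M)))) := by rw [h2]; ring
    _ ≤ (1 + κ) * (ℓ * (M * Real.exp (-(ℓ * M)))) := by gcongr

/-- Increments over blocks of a function whose derivative is equivalent to the hazard rate. -/
lemma SlowRate.eventually_increment (h : SlowRate μ ℓ) (hℓ : 0 < ℓ) {H H' : ℝ → ℝ}
    (hH : ∀ᶠ s in atTop, HasDerivAt H (H' s) s)
    (hH' : Tendsto (fun s => H' s / (μ s * Real.exp (-(ℓ * μ s)))) atTop (𝓝 1))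
    {κ : ℝ} (hκ : 0 < κ) :
    ∀ᶠ i : ℕ in atTop, (1 - κ) * blockHazard μ ℓ i ≤ H (ℓ * (i + 1 : ℕ)) - H (ℓ * i) ∧
      H (ℓ * (i + 1 : ℕ)) - H (ℓ * i) ≤ (1 + κ) * blockHazard μ ℓ i := by
  obtain ⟨η, hη0, hη1, hηu, hηl⟩ := exists_tolerance ℓ hκ
  have hder := (tendsto_mul_natCast hℓ).eventually (eventually_forall_ge_atTop.mpr hH)
  have hrat := (tendsto_mul_natCast hℓ).eventually (eventually_forall_ge_atTop.mpr
    (hH'.eventually (Icc_mem_nhds (show 1 - η < 1 by linarith) (show 1 < 1 + η by linarith))))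
  filter_upwards [h.eventually_bounds hℓ hη0 1, hder, hrat] with i ⟨hi, hB, hw⟩ hd hr
  rw [blockHazard]
  have hlt : ℓ * (i : ℝ) < ℓ * (i + 1 : ℕ) := by push_cast; linarith
  -- By the mean value theorem the increment is `H' ξ * ℓ` with `ξ` in the block, where the rate is
  -- within `η` of its value at the left end.
  obtain ⟨ξ, hξ, hξe⟩ := exists_hasDerivAt_eq_slope H H' hlt
    (fun x hx => (hd x hx.1).continuousAt.continuousWithinAt) (fun x hx => hd x hx.1.le)
  have hlen : ℓ * ((i + 1 : ℕ) : ℝ) - ℓ * i = ℓ := by push_cast; ring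
  rw [hlen, eq_div_iff hℓ.ne'] at hξe
  rw [← hξe]
  have hξ2 : ξ < ℓ * i + ℓ := by have := hξ.2; push_cast at this; linarith
  obtain ⟨hl, hu⟩ := hw ξ ⟨hξ.1.le, by linarith⟩
  have hrξ := hr ξ hξ.1.le
  set M := μ (ℓ * i)
  have hM : 0 < M := by linarith
  have hξpos : 0 < μ ξ := by linarith
  have hφ : 0 < μ ξ * Real.exp (-(ℓ * μ ξ)) := by positivity
  have h1 := (le_div_iff₀ hφ).mp hrξ.1
  have h2 := (div_le_iff₀ hφ).mp hrξ.2
  constructor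
  · calc (1 - κ) * (ℓ * (M * Real.exp (-(ℓ * M))))
        ≤ ((1 - η) ^ 2 * Real.exp (-(ℓ * η))) * (ℓ * (M * Real.exp (-(ℓ * M)))) := by gcongr
      _ = (1 - η) * (((1 - η) * M) * Real.exp (-(ℓ * (M + η)))) * ℓ := by
          rw [show -(ℓ * (M + η)) = -(ℓ * η) + -(ℓ * M) by ring, Real.exp_add]; ring
      _ ≤ (1 - η) * (μ ξ * Real.exp (-(ℓ * μ ξ))) * ℓ := by
          have h3 : (1 - η) * M ≤ μ ξ := by nlinarith
          have : 0 ≤ 1 - η := by linarith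
          gcongr
      _ ≤ H' ξ * ℓ := by gcongr
  · calc H' ξ * ℓ ≤ (1 + η) * (μ ξ * Real.exp (-(ℓ * μ ξ))) * ℓ := by gcongr
      _ ≤ (1 + η) * (((1 + η) * M) * Real.exp (-(ℓ * (M - η)))) * ℓ := by
          have h3 : μ ξ ≤ (1 + η) * M := by nlinarith
          gcongr
      _ = ((1 + η) ^ 2 * Real.exp (ℓ * η)) * (ℓ * (M * Real.exp (-(ℓ * M)))) := by
          rw [show -(ℓ * (M - η)) = (ℓ * η) + -(ℓ * M) by ring, Real.exp_add]; ring
      _ ≤ (1 + κ) * (ℓ * (M * Real.exp (-(ℓ * M)))) := by gcongr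

end Asymptotics

/-! ### The tail in terms of the integrated hazard. -/

section Main

variable {Ω : Type*} [MeasurableSpace Ω] {P : Measure Ω} [IsProbabilityMeasure P]
  {μ : ℝ → ℝ} {N : Ω → Set ℝ} {ℓ : ℝ}

/-- From `exp (-y) ≤ 1 / (1 + y)` with `y = (1 + κ) * x`; the condition on `x` is what makes `(1 -
x) * (1 + y) ≥ 1`. It turns the product over blocks into an exponential of a sum. -/
lemma exp_neg_le_one_sub {κ x : ℝ} (hκ : 0 < κ) (hx : 0 ≤ x) (hxκ : x * (1 + κ) ≤ κ) :
    Real.exp (-((1 + κ) * x)) ≤ 1 - x := by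
  have h1 : Real.exp (-((1 + κ) * x)) ≤ 1 / (1 + (1 + κ) * x) := by
    rw [Real.exp_neg, ← one_div]
    exact one_div_le_one_div_of_le (by positivity) (by linarith [Real.add_one_le_exp ((1 + κ) * x)])
  refine h1.trans ((div_le_iff₀ (by positivity)).mpr ?_)
  nlinarith [mul_nonneg hx (sub_nonneg.mpr hxκ)]

lemma sum_Ico_increments (f : ℕ → ℝ) {a b : ℕ} (h : a ≤ b) :
    ∑ i ∈ Finset.Ico a b, (f (i + 1) - f i) = f b - f a := by
  induction b, h using Nat.le_induction with
  | base => simp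
  | succ n hn ih => rw [Finset.sum_Ico_succ_top hn, ih]; ring

/-- `log P(D > t)` is bounded on both sides by multiples of `H t` close to `-1`, up to constants. -/
lemma SlowRate.eventually_log_tail (h : SlowRate μ ℓ) (hℓ : 0 < ℓ)
    (hμpos : ∀ᵐ t ∂(volume.restrict (Set.Ioi (0 : ℝ))), 0 < μ t)
    (hμint : ∀ t : ℝ, 0 < t → IntegrableOn μ (Set.Ioc 0 t)) (hN : IsPoissonProcess P μ N)
    {H H' : ℝ → ℝ} (hH : ∀ᶠ s in atTop, HasDerivAt H (H' s) s)
    (hH' : Tendsto (fun s => H' s / (μ s * Real.exp (-(ℓ * μ s)))) atTop (𝓝 1))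
    {κ : ℝ} (hκ : 0 < κ) (hκ1 : κ < 1) :
    ∃ C, ∀ᶠ t in atTop, -((1 + κ) * H t) - C ≤ Real.log (tail P N ℓ t) ∧
      Real.log (tail P N ℓ t) ≤ -((1 - κ) * H t) + C := by
  -- Small enough for `(1 - κ) * (1 + κ') ≤ 1 - κ'` and `(1 + κ') ^ 2 ≤ (1 + κ) * (1 - κ')`, which
  -- combine the block errors with the passage to `H`.
  set κ' := κ / 8 with hκ'
  have hκ'0 : 0 < κ' := by positivity
  have hκ'1 : κ' < 1 / 8 := by linarith
  let Δ : ℕ → ℝ := fun i => H (ℓ * (i + 1 : ℕ)) - H (ℓ * i)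
  -- eventual properties of the blocks
  have hmono : ∀ᶠ s in atTop, ∀ x ≥ s, ∀ y ≥ x, H x ≤ H y := by
    have hpos : ∀ᶠ s in atTop, 0 < H' s := by
      filter_upwards [hH'.eventually_const_lt one_pos, h.tendsto.eventually_gt_atTop 0] with s h1 h2
      have : 0 < μ s * Real.exp (-(ℓ * μ s)) := by positivity
      exact (div_pos_iff_of_pos_right this).mp h1
    filter_upwards [eventually_forall_ge_atTop.mpr (hH.and hpos)] with s hs x hx y hxy
    have : MonotoneOn H (Set.Ici s) := by
      refine monotoneOn_of_deriv_nonneg (convex_Ici s)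
        (fun z hz => (hs z hz).1.continuousAt.continuousWithinAt)
        (fun z hz => (hs z (interior_subset hz)).1.differentiableAt.differentiableWithinAt)
        (fun z hz => ?_)
      rw [(hs z (interior_subset hz)).1.deriv]; exact (hs z (interior_subset hz)).2.le
    exact this hx (le_trans hx hxy) hxy
  have hsmall : ∀ᶠ i in atTop, blockHazard μ ℓ i < κ' / 4 :=
    (h.tendsto_blockHazard hℓ).eventually_lt_const (by positivity)
  obtain ⟨i₀, hi₀⟩ := eventually_atTop.mp
    ((h.eventually_le_blockSum hℓ hμint hκ'0).and <|
      (h.eventually_le_real_noRun hℓ hμint hN hκ'0).and <|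
      (h.eventually_increment hℓ hH hH' hκ'0).and <|
      hsmall.and <| (h.blockHazard_pos hℓ).and <| (tendsto_mul_natCast hℓ).eventually hmono)
  have hmono₀ := (hi₀ i₀ le_rfl).2.2.2.2.2
  have hU : ∀ i ≥ i₀, ∀ᶠ m in atTop, (1 - κ) * Δ i ≤ blockSum μ ℓ m i := by
    intro i hi
    obtain ⟨hS, -, ⟨-, hup⟩, -, hpos, -⟩ := hi₀ i hi
    filter_upwards [hS] with m hm
    refine le_trans ?_ hm
    calc (1 - κ) * Δ i ≤ (1 - κ) * ((1 + κ') * blockHazard μ ℓ i) :=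
          mul_le_mul_of_nonneg_left hup (by linarith)
      _ = ((1 - κ) * (1 + κ')) * blockHazard μ ℓ i := by ring
      _ ≤ (1 - κ') * blockHazard μ ℓ i :=
          mul_le_mul_of_nonneg_right (by nlinarith) hpos.le
  have hΔ1 : ∀ i ≥ i₀, Δ i ≤ 1 := by
    intro i hi
    obtain ⟨-, -, ⟨-, hup⟩, hsm, hpos, -⟩ := hi₀ i hi
    refine hup.trans ?_
    nlinarith
  have hL : ∀ i ≥ i₀, ∀ᶠ m in atTop, Real.exp (-((1 + κ) * Δ i)) ≤ P.real (noRun N ℓ m i) := by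
    intro i hi
    obtain ⟨-, hS, ⟨hlow, -⟩, hsm, hpos, -⟩ := hi₀ i hi
    filter_upwards [hS] with m hm
    refine le_trans ?_ hm
    have hsq : (1 + κ') * blockHazard μ ℓ i * (1 + κ') ≤ κ' := by
      have : (1 + κ') * (1 + κ') ≤ 4 := by nlinarith
      calc _ = ((1 + κ') * (1 + κ')) * blockHazard μ ℓ i := by ring
        _ ≤ 4 * (κ' / 4) := mul_le_mul this hsm.le hpos.le (by norm_num)
        _ = κ' := by ring
    refine le_trans ?_ (exp_neg_le_one_sub hκ'0 (by positivity) hsq)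
    refine Real.exp_le_exp.mpr (neg_le_neg ?_)
    calc (1 + κ') * ((1 + κ') * blockHazard μ ℓ i)
        = ((1 + κ') * (1 + κ')) * blockHazard μ ℓ i := by ring
      _ ≤ ((1 + κ) * (1 - κ')) * blockHazard μ ℓ i :=
          mul_le_mul_of_nonneg_right (by rw [show κ = 8 * κ' by linarith]; nlinarith) hpos.le
      _ = (1 + κ) * ((1 - κ') * blockHazard μ ℓ i) := by ring
      _ ≤ (1 + κ) * Δ i := mul_le_mul_of_nonneg_left hlow (by linarith)
  -- The mesh will depend on `t`, so the bounds for the blocks before `i₀` must hold for all `m ≥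
  -- 2`.
  choose c hc0 hc using fun i => exists_le_real_noRun (P := P) hℓ hμpos hμint hN i
  have hprodpos : 0 < ∏ i ∈ Finset.range i₀, c i := Finset.prod_pos fun i _ => hc0 i
  set A := H (ℓ * i₀)
  set c₀ := Real.log (∏ i ∈ Finset.range i₀, c i)
  -- Here `c₀` and `A` come from the early blocks; `2` bounds the growth of `H` from `t` to `ℓ * (n
  -- + 2)`; the factor `2` bounds `1 + κ`.
  refine ⟨|c₀| + 2 * (|A| + 2), ?_⟩
  filter_upwards [eventually_ge_atTop (ℓ * (i₀ + 1 : ℕ))] with t ht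
  -- the block that contains `t`
  set n := ⌊t / ℓ⌋₊
  have ht0 : 0 ≤ t := le_trans (by positivity) ht
  have hnt : ℓ * n ≤ t := by
    have := Nat.floor_le (show 0 ≤ t / ℓ by positivity)
    rw [le_div_iff₀ hℓ] at this; linarith
  have htn : t < ℓ * (n + 1 : ℕ) := by
    have := Nat.lt_floor_add_one (t / ℓ)
    rw [div_lt_iff₀ hℓ] at this; push_cast; linarith
  have hin : i₀ + 1 ≤ n := Nat.le_floor (by rw [le_div_iff₀ hℓ]; linarith)
  have hcast : ∀ {a b : ℕ}, a ≤ b → ℓ * (a : ℝ) ≤ ℓ * b := fun hab =>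
    mul_le_mul_of_nonneg_left (by exact_mod_cast hab) hℓ.le
  have hHt1 : H (ℓ * n) ≤ H t := hmono₀ _ (hcast (by omega)) _ hnt
  have hHt2 : H t ≤ H (ℓ * (n + 1 : ℕ)) :=
    hmono₀ _ ((hcast (by omega)).trans hnt) _ htn.le
  have hstep1 : H (ℓ * (n + 1 : ℕ)) - H (ℓ * n) ≤ 1 := hΔ1 n (by omega)
  have hstep2 : H (ℓ * (n + 1 + 1 : ℕ)) - H (ℓ * (n + 1 : ℕ)) ≤ 1 := hΔ1 (n + 1) (by omega)
  -- a fine enough mesh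
  obtain ⟨m, hm2, hmU, hmL⟩ : ∃ m : ℕ, 2 ≤ m ∧
      (∀ i ∈ Finset.Ico i₀ n, (1 - κ) * Δ i ≤ blockSum μ ℓ m i) ∧
      (∀ i ∈ Finset.Ico i₀ (n + 2), Real.exp (-((1 + κ) * Δ i)) ≤ P.real (noRun N ℓ m i)) := by
    refine ((eventually_ge_atTop 2).and (Eventually.and ?_ ?_)).exists
    · exact (eventually_all_finset _).mpr fun i hi => hU i (Finset.mem_Ico.mp hi).1
    · exact (eventually_all_finset _).mpr fun i hi => hL i (Finset.mem_Ico.mp hi).1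
  have hm : 0 < m := by omega
  have hlow : (∏ i ∈ Finset.range i₀, c i) *
      Real.exp (-((1 + κ) * (H (ℓ * (n + 1 + 1 : ℕ)) - A))) ≤ tail P N ℓ t := by
    refine le_trans ?_ (prod_noRun_le_tail (n := n + 1) hℓ hm hN (by omega) htn)
    rw [← Finset.prod_range_mul_prod_Ico _ (show i₀ ≤ n + 1 + 1 by omega),
      ← sum_Ico_increments (fun i => H (ℓ * (i : ℕ))) (show i₀ ≤ n + 1 + 1 by omega),
      Finset.mul_sum, ← Finset.sum_neg_distrib, Real.exp_sum]
    refine mul_le_mul (Finset.prod_le_prod (fun i _ => (hc0 i).le) fun i _ => hc i m hm2)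
      (Finset.prod_le_prod (fun i _ => (Real.exp_pos _).le) hmL)
      (Finset.prod_nonneg fun i _ => (Real.exp_pos _).le)
      (Finset.prod_nonneg fun i _ => measureReal_nonneg)
  have htail : 0 < tail P N ℓ t := lt_of_lt_of_le (by positivity) hlow
  have hupp : tail P N ℓ t ≤ Real.exp (-((1 - κ) * (H (ℓ * n) - A))) := by
    refine (tail_le_exp_blockSum hℓ hm hμint hN hnt).trans
      (Real.exp_le_exp.mpr (neg_le_neg ?_))
    rw [← Finset.sum_range_add_sum_Ico _ (show i₀ ≤ n by omega),
      ← sum_Ico_increments (fun i => H (ℓ * (i : ℕ))) (show i₀ ≤ n by omega), Finset.mul_sum]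
    have h1 := Finset.sum_le_sum hmU
    have h2 : 0 ≤ ∑ i ∈ Finset.range i₀, blockSum μ ℓ m i :=
      Finset.sum_nonneg fun i _ => blockSum_nonneg i
    linarith
  have hA := abs_le.mp (le_refl |A|)
  have hc₀ := abs_le.mp (le_refl |c₀|)
  constructor
  · have h1 := Real.log_le_log (by positivity) hlow
    rw [Real.log_mul hprodpos.ne' (Real.exp_pos _).ne', Real.log_exp] at h1
    have h2 : (1 + κ) * (H (ℓ * (n + 1 + 1 : ℕ)) - A) ≤ (1 + κ) * (H t + 2 + |A|) :=
      mul_le_mul_of_nonneg_left (by linarith [hA.1]) (by linarith)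
    have h3 : (1 + κ) * (2 + |A|) ≤ 2 * (2 + |A|) :=
      mul_le_mul_of_nonneg_right (by linarith) (by positivity)
    linarith [hc₀.1]
  · have h1 := Real.log_le_log htail hupp
    rw [Real.log_exp] at h1
    have h2 : (1 - κ) * (H t - 1 - |A|) ≤ (1 - κ) * (H (ℓ * n) - A) :=
      mul_le_mul_of_nonneg_left (by linarith [hA.2]) (by linarith)
    have h3 : (1 - κ) * (1 + |A|) ≤ 2 * (2 + |A|) :=
      mul_le_mul (by linarith) (by linarith) (by positivity) (by norm_num)
    linarith [abs_nonneg c₀]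

/-- If the hazard rate `μ e^{-ℓ μ}` is equivalent to the derivative of a function `H` that tends to
infinity, then `log P(D > t)` is equivalent to `-H t`. -/
theorem SlowRate.logAsymp_tail (h : SlowRate μ ℓ) (hℓ : 0 < ℓ)
    (hμpos : ∀ᵐ t ∂(volume.restrict (Set.Ioi (0 : ℝ))), 0 < μ t)
    (hμint : ∀ t : ℝ, 0 < t → IntegrableOn μ (Set.Ioc 0 t)) (hN : IsPoissonProcess P μ N)
    {H H' : ℝ → ℝ} (hH : ∀ᶠ s in atTop, HasDerivAt H (H' s) s)
    (hH' : Tendsto (fun s => H' s / (μ s * Real.exp (-(ℓ * μ s)))) atTop (𝓝 1))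
    (hHtop : Tendsto H atTop atTop) :
    Tendsto (fun t => Real.log (tail P N ℓ t) / (-H t)) atTop (𝓝 1) := by
  rw [Metric.tendsto_nhds]
  intro ε hε
  -- The relative error `κ` and the constant `C` each cost at most `ε / 4 * H t`.
  set κ := min (ε / 4) (1 / 2)
  have hκ0 : 0 < κ := by positivity
  have hκε : κ ≤ ε / 4 := min_le_left _ _
  obtain ⟨C, hC⟩ := h.eventually_log_tail hℓ hμpos hμint hN hH hH' hκ0
    (lt_of_le_of_lt (min_le_right _ _) (by norm_num))
  filter_upwards [hC, hHtop.eventually_gt_atTop 0,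
    hHtop.eventually_ge_atTop (C / (ε / 4))] with t ht hpos hbig
  rw [div_le_iff₀ (by positivity)] at hbig
  rw [Real.dist_eq, div_neg, ← neg_div, div_sub_one hpos.ne', abs_div, abs_of_pos hpos,
    div_lt_iff₀ hpos, abs_lt]
  have h1 : κ * H t ≤ ε / 4 * H t := by gcongr
  have h2 : 0 < ε * H t := by positivity
  constructor <;> linarith [ht.1, ht.2]

end Main

/-! ### The explicit logarithmic rates. -/

section LogRates

lemma tendsto_logRate_div (α β γ : ℝ) :
    Tendsto (fun x : ℝ => (α * x + β * Real.log x + γ) / x) atTop (𝓝 α) := by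
  have h1 : Tendsto (fun x : ℝ => Real.log x / x) atTop (𝓝 0) :=
    Real.isLittleO_log_id_atTop.tendsto_div_nhds_zero
  have h2 : Tendsto (fun x : ℝ => γ / x) atTop (𝓝 0) := tendsto_const_nhds.div_atTop tendsto_id
  have h3 : Tendsto (fun x : ℝ => α + β * (Real.log x / x) + γ / x) atTop (𝓝 α) := by
    simpa using ((h1.const_mul β).const_add α).add h2
  refine h3.congr' ?_
  filter_upwards [eventually_gt_atTop 0] with x hx
  field_simp

lemma tendsto_logRate_ratio {α : ℝ} (hα : α ≠ 0) (β γ δ : ℝ) :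
    Tendsto (fun t : ℝ => (α * Real.log t + δ) /
      (α * Real.log t + β * Real.log (Real.log t) + γ)) atTop (𝓝 1) := by
  have h1 := (tendsto_logRate_div α 0 δ).div (tendsto_logRate_div α β γ) hα
  rw [div_self hα] at h1
  have h2 := h1.comp Real.tendsto_log_atTop
  refine h2.congr' ?_
  filter_upwards [Real.tendsto_log_atTop.eventually_gt_atTop 0] with t ht
  simp only [Function.comp, Pi.div_apply, zero_mul, add_zero]
  exact div_div_div_cancel_right₀ ht.ne' _ _

/-- All three rates have this form. Over a window of length `2 * ℓ` from `s`, both `log` and `log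
log` grow by at most `2 * ℓ / s` once `log s ≥ 1`. -/
lemma slowRate_of_log {μ : ℝ → ℝ} {ℓ α β γ : ℝ} (hα : 0 < α)
    (hμ : ∀ᶠ t in atTop, μ t = α * Real.log t + β * Real.log (Real.log t) + γ) :
    SlowRate μ ℓ where
  tendsto := by
    have h1 := ((tendsto_logRate_div α β γ).pos_mul_atTop hα tendsto_id).comp
      Real.tendsto_log_atTop
    refine h1.congr' ?_
    filter_upwards [hμ, Real.tendsto_log_atTop.eventually_gt_atTop 0] with t ht hpos
    simp only [Function.comp, id, ht]
    exact div_mul_cancel₀ _ hpos.ne'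
  slow := by
    intro η hη
    have hlim : Tendsto (fun s : ℝ => (α + |β|) * (2 * ℓ / s)) atTop (𝓝 0) := by
      simpa using (tendsto_const_nhds.div_atTop tendsto_id).const_mul (α + |β|)
    filter_upwards [eventually_forall_ge_atTop.mpr hμ, hlim.eventually_lt_const hη,
      Real.tendsto_log_atTop.eventually_ge_atTop 1, eventually_gt_atTop 0] with s hs hlt hlog hs0 x hx
    have hlogle : ∀ {u v : ℝ}, 0 < u → u ≤ v → Real.log v - Real.log u ≤ (v - u) / u := by
      intro u v hu huv
      have hv : 0 < v := hu.trans_le huv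
      rw [← Real.log_div hv.ne' hu.ne', sub_div, div_self hu.ne']
      exact Real.log_le_sub_one_of_pos (by positivity)
    have hx0 : 0 < x := hs0.trans_le hx.1
    have hl0 : 0 ≤ Real.log x - Real.log s := sub_nonneg.mpr (Real.log_le_log hs0 hx.1)
    have hl1 : Real.log x - Real.log s ≤ 2 * ℓ / s :=
      (hlogle hs0 hx.1).trans (by have := hx.2; gcongr; linarith)
    have hll0 : 0 ≤ Real.log (Real.log x) - Real.log (Real.log s) :=
      sub_nonneg.mpr (Real.log_le_log (by linarith) (by linarith))
    have hll1 : Real.log (Real.log x) - Real.log (Real.log s) ≤ 2 * ℓ / s :=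
      (hlogle (by linarith) (by linarith)).trans ((div_le_self hl0 hlog).trans hl1)
    rw [hs x hx.1, hs s le_rfl]
    calc |α * Real.log x + β * Real.log (Real.log x) + γ
          - (α * Real.log s + β * Real.log (Real.log s) + γ)|
        = |α * (Real.log x - Real.log s)
          + β * (Real.log (Real.log x) - Real.log (Real.log s))| := by ring_nf
      _ ≤ |α * (Real.log x - Real.log s)|
          + |β * (Real.log (Real.log x) - Real.log (Real.log s))| := abs_add_le _ _
      _ = α * (Real.log x - Real.log s)
          + |β| * (Real.log (Real.log x) - Real.log (Real.log s)) := by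
        rw [abs_mul, abs_mul, abs_of_pos hα, abs_of_nonneg hl0, abs_of_nonneg hll0]
      _ ≤ α * (2 * ℓ / s) + |β| * (2 * ℓ / s) := by gcongr
      _ ≤ η := by linarith

variable {Ω : Type*} [MeasurableSpace Ω] {P : Measure Ω} [IsProbabilityMeasure P]
  {μ : ℝ → ℝ} {N : Ω → Set ℝ} {ℓ : ℝ}

theorem logAsymp_tail_of_log_rate (hℓ : 0 < ℓ)
    (hμpos : ∀ᵐ t ∂(volume.restrict (Set.Ioi (0 : ℝ))), 0 < μ t)
    (hμint : ∀ t : ℝ, 0 < t → IntegrableOn μ (Set.Ioc 0 t)) (hN : IsPoissonProcess P μ N)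
    {a b : ℝ} (ha : 0 < a) (hb : 0 < b) (hbℓ : b < 1 / ℓ)
    (hμ : ∀ᶠ t in atTop, μ t = b * Real.log t - Real.log a) :
    LogAsymp (fun t => tail P N ℓ t)
      (fun t => Real.exp (-(b * a ^ ℓ / (1 - b * ℓ) * t ^ (1 - b * ℓ) * Real.log t))) := by
  have hd : 0 < 1 - b * ℓ := by rw [lt_div_iff₀ hℓ] at hbℓ; linarith
  have hμ' : ∀ᶠ t in atTop,
      μ t = b * Real.log t + 0 * Real.log (Real.log t) + -Real.log a := by
    filter_upwards [hμ] with t ht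
    rw [ht]; ring
  have haℓ : 0 < a ^ ℓ := Real.rpow_pos_of_pos ha ℓ
  unfold LogAsymp
  simp only [Real.log_exp]
  refine (slowRate_of_log hb hμ').logAsymp_tail hℓ hμpos hμint hN
    (H' := fun t => b * a ^ ℓ / (1 - b * ℓ) * ((1 - b * ℓ) * t ^ (1 - b * ℓ - 1)) * Real.log t
      + b * a ^ ℓ / (1 - b * ℓ) * t ^ (1 - b * ℓ) * t⁻¹) ?_ ?_ ?_
  · filter_upwards [eventually_gt_atTop 0] with t ht
    exact ((Real.hasDerivAt_rpow_const (Or.inl ht.ne')).const_mul _).mul (Real.hasDerivAt_log ht.ne')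
  -- The hazard is `μ t * a ^ ℓ * t ^ (-(b * ℓ))`. Differentiating `log t` in `H` yields the
  -- lower-order term `b / (1 - b * ℓ)`, negligible against `b * log t`.
  · refine (tendsto_logRate_ratio hb.ne' 0 (-Real.log a) (b / (1 - b * ℓ))).congr' ?_
    filter_upwards [hμ', eventually_gt_atTop 0] with t ht ht0
    have hp : (0 : ℝ) < t ^ (-(b * ℓ)) := Real.rpow_pos_of_pos ht0 _
    have e1 : t ^ (1 - b * ℓ - 1) = t ^ (-(b * ℓ)) := by ring_nf
    have e2 : t ^ (1 - b * ℓ) * t⁻¹ = t ^ (-(b * ℓ)) := by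
      rw [← Real.rpow_neg_one t, ← Real.rpow_add ht0]; ring_nf
    have e3 : Real.exp (-(ℓ * (b * Real.log t + 0 * Real.log (Real.log t) + -Real.log a)))
        = t ^ (-(b * ℓ)) * a ^ ℓ := by
      rw [Real.rpow_def_of_pos ht0, Real.rpow_def_of_pos ha, ← Real.exp_add]; ring_nf
    rw [ht, e3, mul_assoc _ (t ^ (1 - b * ℓ)), e2, e1]
    have e4 : b * a ^ ℓ / (1 - b * ℓ) * ((1 - b * ℓ) * t ^ (-(b * ℓ))) * Real.log t
        + b * a ^ ℓ / (1 - b * ℓ) * t ^ (-(b * ℓ))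
        = (b * Real.log t + b / (1 - b * ℓ)) * (t ^ (-(b * ℓ)) * a ^ ℓ) := by
      field_simp
    rw [e4, mul_div_mul_right _ _ (by positivity)]
  · exact ((tendsto_rpow_atTop hd).const_mul_atTop (by positivity)).atTop_mul_atTop₀
      Real.tendsto_log_atTop

theorem logAsymp_tail_of_log_rate_sub (hμpos : ∀ᵐ t ∂(volume.restrict (Set.Ioi (0 : ℝ))), 0 < μ t)
    (hμint : ∀ t : ℝ, 0 < t → IntegrableOn μ (Set.Ioc 0 t)) (hN : IsPoissonProcess P μ N)
    {a b : ℝ} (ha : 0 < a) (hb : -2 < b)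
    (hμ : ∀ᶠ t in atTop, μ t = Real.log t - b * Real.log (Real.log t) - Real.log a) :
    LogAsymp (fun t => tail P N 1 t)
      (fun t => Real.exp (-(a / (2 + b) * Real.log t ^ (2 + b)))) := by
  have hd : 0 < 2 + b := by linarith
  have hμ' : ∀ᶠ t in atTop,
      μ t = 1 * Real.log t + (-b) * Real.log (Real.log t) + -Real.log a := by
    filter_upwards [hμ] with t ht
    rw [ht]; ring
  unfold LogAsymp
  simp only [Real.log_exp]
  refine (slowRate_of_log one_pos hμ').logAsymp_tail one_pos hμpos hμint hN
    (H' := fun t => a / (2 + b) * (t⁻¹ * (2 + b) * Real.log t ^ (2 + b - 1))) ?_ ?_ ?_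
  · filter_upwards [eventually_gt_atTop 1] with t ht
    have hl := Real.log_pos ht
    exact ((Real.hasDerivAt_log (by linarith)).rpow_const (Or.inl hl.ne')).const_mul _
  -- The hazard is `μ t * a * (log t) ^ b / t` and `H' t = a * (log t) ^ (b + 1) / t`, so the ratio
  -- is `log t / μ t`.
  · refine (tendsto_logRate_ratio one_ne_zero (-b) (-Real.log a) 0).congr' ?_
    filter_upwards [hμ', eventually_gt_atTop 1] with t ht ht1
    have ht0 : 0 < t := by linarith
    have hl := Real.log_pos ht1
    have hp : (0 : ℝ) < Real.log t ^ b := Real.rpow_pos_of_pos hl _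
    have e1 : Real.log t ^ (2 + b - 1) = Real.log t ^ b * Real.log t := by
      rw [show 2 + b - 1 = b + 1 by ring, Real.rpow_add_one hl.ne']
    have e3 : Real.exp (-(1 * (1 * Real.log t + -b * Real.log (Real.log t) + -Real.log a)))
        = Real.log t ^ b * (a * t⁻¹) := by
      rw [Real.rpow_def_of_pos hl, show -(1 * (1 * Real.log t + -b * Real.log (Real.log t)
        + -Real.log a)) = Real.log (Real.log t) * b + (Real.log a + -Real.log t) by ring,
        Real.exp_add, Real.exp_add, Real.exp_neg, Real.exp_log ha, Real.exp_log ht0]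
    rw [ht, e3, e1]
    have e4 : a / (2 + b) * (t⁻¹ * (2 + b) * (Real.log t ^ b * Real.log t))
        = (1 * Real.log t + 0) * (Real.log t ^ b * (a * t⁻¹)) := by
      field_simp
      ring
    rw [e4, mul_div_mul_right _ _ (by positivity)]
  · exact ((tendsto_rpow_atTop hd).comp Real.tendsto_log_atTop).const_mul_atTop (by positivity)

theorem logAsymp_tail_of_log_rate_add (hμpos : ∀ᵐ t ∂(volume.restrict (Set.Ioi (0 : ℝ))), 0 < μ t)
    (hμint : ∀ t : ℝ, 0 < t → IntegrableOn μ (Set.Ioc 0 t)) (hN : IsPoissonProcess P μ N)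
    {a : ℝ} (ha : 0 < a)
    (hμ : ∀ᶠ t in atTop, μ t = Real.log t + 2 * Real.log (Real.log t) - Real.log a) :
    LogAsymp (fun t => tail P N 1 t) (fun t => Real.log t ^ (-a)) := by
  have hμ' : ∀ᶠ t in atTop,
      μ t = 1 * Real.log t + 2 * Real.log (Real.log t) + -Real.log a := by
    filter_upwards [hμ] with t ht
    rw [ht]; ring
  have hmain := (slowRate_of_log one_pos hμ').logAsymp_tail one_pos hμpos hμint hN
    (H := fun t => a * Real.log (Real.log t)) (H' := fun t => a * (t⁻¹ / Real.log t)) ?_ ?_ ?_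
  · refine hmain.congr' ?_
    filter_upwards [eventually_gt_atTop 1] with t ht
    rw [Real.log_rpow (Real.log_pos ht), neg_mul]
  · filter_upwards [eventually_gt_atTop 1] with t ht
    exact ((Real.hasDerivAt_log (by linarith)).log (Real.log_pos ht).ne').const_mul _
  -- The hazard is `μ t * a / (t * (log t) ^ 2)` and `H' t = a / (t * log t)`, so the ratio is again
  -- `log t / μ t`.
  · refine (tendsto_logRate_ratio one_ne_zero 2 (-Real.log a) 0).congr' ?_
    filter_upwards [hμ', eventually_gt_atTop 1] with t ht ht1
    have ht0 : 0 < t := by linarith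
    have hl := Real.log_pos ht1
    have e3 : Real.exp (-(1 * (1 * Real.log t + 2 * Real.log (Real.log t) + -Real.log a)))
        = a * t⁻¹ * ((Real.log t)⁻¹ * (Real.log t)⁻¹) := by
      rw [show -(1 * (1 * Real.log t + 2 * Real.log (Real.log t) + -Real.log a))
        = Real.log a + -Real.log t + (-Real.log (Real.log t) + -Real.log (Real.log t)) by ring,
        Real.exp_add, Real.exp_add, Real.exp_add, Real.exp_neg, Real.exp_neg, Real.exp_log ha,
        Real.exp_log ht0, Real.exp_log hl]
    rw [ht, e3]
    have e4 : a * (t⁻¹ / Real.log t)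
        = (1 * Real.log t + 0) * (a * t⁻¹ * ((Real.log t)⁻¹ * (Real.log t)⁻¹)) := by
      field_simp
      ring
    rw [e4, mul_div_mul_right _ _ (by positivity)]
  · exact (Real.tendsto_log_atTop.comp Real.tendsto_log_atTop).const_mul_atTop ha

end LogRates

end PoissonGap

end

theorem mainTheorem7 {Ω : Type*} [MeasurableSpace Ω] (P : Measure Ω) [IsProbabilityMeasure P]
    (μ : ℝ → ℝ) (N : Ω → Set ℝ) (ℓ : ℝ) (hℓ : 0 < ℓ)
    (hμpos : ∀ᵐ t ∂(volume.restrict (Set.Ioi (0 : ℝ))), 0 < μ t)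
    (hμint : ∀ t : ℝ, 0 < t → IntegrableOn μ (Set.Ioc 0 t))
    (hN : PoissonGap.IsPoissonProcess P μ N) :
    (∀ a b : ℝ, 0 < a → 0 < b → b < 1 / ℓ →
      (∀ᶠ t in atTop, μ t = b * Real.log t - Real.log a) →
      PoissonGap.LogAsymp (fun t => PoissonGap.tail P N ℓ t)
        (fun t => Real.exp (-(b * a ^ ℓ / (1 - b * ℓ) * t ^ (1 - b * ℓ) * Real.log t)))) ∧
    (ℓ = 1 → ∀ a b : ℝ, 0 < a → -2 < b →
      (∀ᶠ t in atTop, μ t = Real.log t - b * Real.log (Real.log t) - Real.log a) →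
      PoissonGap.LogAsymp (fun t => PoissonGap.tail P N ℓ t)
        (fun t => Real.exp (-(a / (2 + b) * Real.log t ^ (2 + b))))) ∧
    (ℓ = 1 → ∀ a : ℝ, 0 < a →
      (∀ᶠ t in atTop, μ t = Real.log t + 2 * Real.log (Real.log t) - Real.log a) →
      PoissonGap.LogAsymp (fun t => PoissonGap.tail P N ℓ t)
        (fun t => Real.log t ^ (-a))) := by
  refine ⟨fun a b ha hb hbℓ h =>
    PoissonGap.logAsymp_tail_of_log_rate hℓ hμpos hμint hN ha hb hbℓ h, ?_, ?_⟩
  · rintro rfl a b ha hb h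
    exact PoissonGap.logAsymp_tail_of_log_rate_sub hμpos hμint hN ha hb h
  · rintro rfl a ha h
    exact PoissonGap.logAsymp_tail_of_log_rate_add hμpos hμint hN ha h
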